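/- **Theorem 6.1.** Let $n\ge s\ge 1$ and let $X=(x_i^j)$ be a real $s\times(n+1)$ matrix with columns $x^0,\dots,x^n\in\mathbb R^s$ whose convex hull $[X]$ has positive $s$-dimensional volume. Let $d\in\mathbb R^{n+1}$ have positive components and let $h$ be a continuous complex-valued function on $I=[\min x_i^j,\max x_i^j]$. For $\beta=(\beta_0,\dots,\beta_m)$ with positive components, let $$\phi_\beta(t)=\Gamma(\beta_0+\cdots+\beta_m)\prod_{i=0}^m\frac{t_i^{\beta_i-1}}{\Gamma(\beta_i)},\qquad t_0=1-t_1-\cdots-t_m,$$ be the Dirichlet density on $E_m=\{t\in\mathbb R^m: t_j\ge0,\ \sum_{j=1}^m t_j\le1\}$. The Dirichlet spline $M(\cdot|d;X)$ is the locally integrable function on $\mathbb R^s$, unique up to a null set, with $$\int_{\mathbb R^s}f(x)M(x|d;X)\,dx=\int_{E_n}f\Big(\sum_{j=0}^n t_jx^j\Big)\phi_d(t)\,dt$$ for all continuous $f:\mathbb R^s\to\mathbb R$ with compact support. For $b=(b_1,\dots,b_s)$ with positive components and $x\in[X]$ let $$H(b;x)=\int_{E_{s-1}}h\Big(\sum_{i=1}^s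 u_ix_i\Big)\phi_b(u)\,du,\qquad \mathcal H(b;X;d)=\int_{E_n}\int_{E_{s-1}}h\Big(\sum_{i=1}^s\sum_{j=0}^n u_ix_i^jv_j\Big)\phi_b(u)\phi_d(v)\,du\,dv,$$ where $u_1=1-u_2-\cdots-u_s$, $v_0=1-v_1-\cdots-v_n$, $du=du_2\cdots du_s$, $dv=dv_1\cdots dv_n$. Then $M(\cdot|d;X)$ exists, and the identity $$\mathcal H(b;X;d)=\int_{[X]}M(x|d;X)\,H(b;x)\,dx\tag{$*$}$$ holds, with an integrable integrand, in each of the following cases. 1. $b\in\mathbb R^s$ has positive components. 2. $b\in V$, where $V\subseteq\mathbb C^s$ is any connected open set that contains all real vectors with positive components and to which the functions $H(\cdot\,;x)$, $x\in[X]$, continue analytically in $b$ with $H(b;x)$ continuous in $(b,x)\in V\times[X]$. In this case $\mathcal H(\cdot\,;X;d)$ continues analytically to $V$, and both sides of $(*)$ denote the continued functions. 3. $h$ is infinitely differentiable on $I$, and $b\in\mathbb C^s$ (in particular $b\in\mathbb R^s$) satisfies $c=b_1+\cdots+b_s\ne0,-1,-2,\dots$. In this case $H(\cdot\,;x)$,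 for every $x\in[X]$, and $\mathcal H(\cdot\,;X;d)$ continue analytically to the set of all such $b\in\mathbb C^s$, and both sides of $(*)$ denote the continued functions. -/

import Mathlib

open MeasureTheory Set
open scoped ContDiff

noncomputable section

/-- The standard simplex `E_m = {t ∈ ℝ^m : t_j ≥ 0, ∑ t_j ≤ 1}`. -/
def stdSimplexE (m : ℕ) : Set (Fin m → ℝ) :=
  {t | (∀ j, 0 ≤ t j) ∧ ∑ j, t j ≤ 1}

/-- The barycentric weights `(1 - t_1 - ⋯ - t_m, t_1, …, t_m)` of a point `t ∈ E_m`. -/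
def baryWeights {m : ℕ} (t : Fin m → ℝ) : Fin (m + 1) → ℝ :=
  Fin.cons (1 - ∑ j, t j) t

/-- The Dirichlet density `φ_b(t) = Γ(c) ∏ Γ(b_i)⁻¹ t_i ^ (b_i - 1)` on `E_m`, where
`c = ∑ b_i` and `t_0 = 1 - t_1 - ⋯ - t_m`, for a real parameter vector `b`. -/
def dirichletDensity {m : ℕ} (b : Fin (m + 1) → ℝ) (t : Fin m → ℝ) : ℝ :=
  Real.Gamma (∑ i, b i) *
    ∏ i, (Real.Gamma (b i))⁻¹ * baryWeights t i ^ (b i - 1)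

/-- `M` is (a version of) the multivariate Dirichlet spline `M(· | d; X)`: the locally integrable
function, unique up to a null set, with `∫ f(x) M(x) dx = ∫_{E_n} f(Xt) φ_d(t) dt` for every
continuous `f` with compact support. Here `Xt = ∑ t_j x^j`, and `X j` is the point `x^j`. -/
def IsDirichletSpline {n s : ℕ} (d : Fin (n + 1) → ℝ) (X : Fin (n + 1) → Fin s → ℝ)
    (M : (Fin s → ℝ) → ℝ) : Prop :=
  LocallyIntegrable M volume ∧
    ∀ f : (Fin s → ℝ) → ℝ, Continuous f → HasCompactSupport f →
      ∫ x, f x * M x =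
        ∫ t in stdSimplexE n, f (∑ j, baryWeights t j • X j) * dirichletDensity d t

/-- The single Dirichlet average `H(b; z) = ∫_{E_m} h(∑ u_i z_i) φ_b(u) du` of `h`,
used for `b` with positive components. -/
def dirichletAverage {m : ℕ} (h : ℝ → ℂ) (b : Fin (m + 1) → ℝ) (z : Fin (m + 1) → ℝ) : ℂ :=
  ∫ u in stdSimplexE m, h (∑ i, baryWeights u i * z i) * (dirichletDensity b u : ℂ)

/-- The double Dirichlet average
`ℋ(b; X; d) = ∫_{E_n} ∫_{E_{s-1}} h(u · Xv) φ_b(u) φ_d(v) du dv` of `h`, with `s = r + 1`,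
used for `b` and `d` with positive components. -/
def doubleDirichletAverage {n r : ℕ} (h : ℝ → ℂ) (b : Fin (r + 1) → ℝ)
    (X : Fin (n + 1) → Fin (r + 1) → ℝ) (d : Fin (n + 1) → ℝ) : ℂ :=
  ∫ v in stdSimplexE n, ∫ u in stdSimplexE r,
    h (∑ i, ∑ j, baryWeights u i * X j i * baryWeights v j) *
      (dirichletDensity b u : ℂ) * (dirichletDensity d v : ℂ)

/-- The interval `I = [min x_i^j, max x_i^j]` spanned by the entries of the matrix `X`. -/
def entryInterval {n r : ℕ} (X : Fin (n + 1) → Fin (r + 1) → ℝ) : Set ℝ :=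
  Icc (⨅ j, ⨅ i, X j i) (⨆ j, ⨆ i, X j i)

/-- The complex parameter vectors `b` with `c = ∑ b_i ≠ 0, -1, -2, …`. -/
def regularParams (s : ℕ) : Set (Fin s → ℂ) :=
  {b | ∀ k : ℕ, ∑ i, b i ≠ -(k : ℂ)}

/-- A region of continuation: a connected open set of complex parameter vectors which contains
all real vectors with positive components. -/
def IsContinuationRegion {s : ℕ} (V : Set (Fin s → ℂ)) : Prop :=
  IsOpen V ∧ IsPreconnected V ∧
    ∀ b : Fin s → ℝ, (∀ i, 0 < b i) → (fun i => (b i : ℂ)) ∈ V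

/-- `F` is the analytic continuation to `V` of the function `F₀` of real vectors with positive
components: `F` is holomorphic on `V` and agrees with `F₀` at those vectors. -/
def IsAnalyticContinuation {s : ℕ} (V : Set (Fin s → ℂ)) (F₀ : (Fin s → ℝ) → ℂ)
    (F : (Fin s → ℂ) → ℂ) : Prop :=
  DifferentiableOn ℂ F V ∧
    ∀ b : Fin s → ℝ, (∀ i, 0 < b i) → F (fun i => (b i : ℂ)) = F₀ b

end

/-!
Divided by `Γ(∑ b_i)`, the single average becomes a function `R(b; h; z)` which is holomorphic for
`Re b_i > 0`, by dominated convergence. Integration by parts on the simplex gives, for every `k`,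
`R(b; h) = (∑ b_i) R(b + e_k; h) + ∑ i, b_i (z_i - z_k) R(b + e_i + e_k; h')`,
and the right-hand side makes sense for smaller `Re b_k` than the left-hand side. For smooth `h`,
iteration continues `R` to larger and larger half spaces, hence to all `b`, and multiplication by
`Γ(∑ b_i)` leaves only the singularities at `∑ b_i = 0, -1, -2, …`.

The Dirichlet spline is the density of the push-forward of the Dirichlet distribution under
`t ↦ ∑ t_j x^j`, which is absolutely continuous since the positive volume of the convex hull makes
the linear part of this map surjective. For positive `b` the identity is the defining property of
the spline, applied to the continuous function `H(b; ·)`. A continuation of the single averages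
integrated against the spline is holomorphic in `b`, and the identity theorem extends the identity
from positive to complex `b`.
-/

open Filter Topology

section Holomorphy

variable {E F α : Type*} [NormedAddCommGroup E] [NormedSpace ℂ E] [NormedAddCommGroup F]
  [NormedSpace ℂ F] [MeasurableSpace α] {μ : Measure α}

theorem aestronglyMeasurable_fderiv_apply_param {K : E → α → F} {b₀ : E}
    (hmeas : ∀ᶠ b in 𝓝 b₀, AEStronglyMeasurable (K b) μ)
    (hdiff : ∀ᵐ t ∂μ, DifferentiableAt ℂ (K · t) b₀) (v : E) :
    AEStronglyMeasurable (fun t => fderiv ℂ (K · t) b₀ v) μ := by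
  have hnorm : Tendsto (fun k : ℕ => ‖(k : ℂ)‖) atTop atTop := by
    simpa only [Complex.norm_natCast] using tendsto_natCast_atTop_atTop
  have hlim : Tendsto (fun k : ℕ => b₀ + (k : ℂ)⁻¹ • v) atTop (𝓝 b₀) := by
    simpa using tendsto_const_nhds.add
      ((tendsto_inv_atTop_nhds_zero_nat (𝕜 := ℂ)).smul_const v)
  obtain ⟨N, hN⟩ := eventually_atTop.1 (hlim.eventually hmeas)
  refine aestronglyMeasurable_of_tendsto_ae (u := atTop)
    (f := fun k t => ((k + N : ℕ) : ℂ) • (K (b₀ + ((k + N : ℕ) : ℂ)⁻¹ • v) t - K b₀ t))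
    (fun k => ((hN _ (Nat.le_add_left _ _)).sub hmeas.self_of_nhds).const_smul _) ?_
  filter_upwards [hdiff] with t ht
  exact (ht.hasFDerivAt.lim v hnorm).comp (tendsto_add_atTop_nat N)

theorem aestronglyMeasurable_fderiv_param [FiniteDimensional ℂ E] {K : E → α → F} {b₀ : E}
    (hmeas : ∀ᶠ b in 𝓝 b₀, AEStronglyMeasurable (K b) μ)
    (hdiff : ∀ᵐ t ∂μ, DifferentiableAt ℂ (K · t) b₀) :
    AEStronglyMeasurable (fun t => fderiv ℂ (K · t) b₀) μ := by
  let e := Module.finBasis ℂ E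
  have hsum : (fun t => fderiv ℂ (K · t) b₀) = fun t => ∑ i,
      ContinuousLinearMap.smulRightL ℂ E F (LinearMap.toContinuousLinearMap (e.coord i))
        (fderiv ℂ (K · t) b₀ (e i)) := by
    ext t v
    conv_lhs => rw [← e.sum_repr v, map_sum]
    simp
  rw [hsum]
  exact Finset.aestronglyMeasurable_fun_sum _ fun i _ =>
    (ContinuousLinearMap.continuous _).comp_aestronglyMeasurable
      (aestronglyMeasurable_fderiv_apply_param hmeas hdiff _)

theorem norm_fderiv_le_of_forall_ball_norm_le {f : E → F} {x : E} {C ε : ℝ} (hε : 0 < ε)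
    (hf : DifferentiableOn ℂ f (Metric.ball x ε)) (hC : ∀ y ∈ Metric.ball x ε, ‖f y‖ ≤ C) :
    ‖fderiv ℂ f x‖ ≤ 2 * C / ε := by
  refine Complex.norm_fderiv_le_div_of_mapsTo_ball hf (fun y hy => ?_) hε
  rw [Metric.mem_closedBall, dist_eq_norm, two_mul]
  exact (norm_sub_le _ _).trans (add_le_add (hC y hy) (hC x (Metric.mem_ball_self hε)))

theorem differentiableAt_integral_of_dominated [FiniteDimensional ℂ E] {K : E → α → F} {b₀ : E}
    {U : Set E} (hU : U ∈ 𝓝 b₀) (hmeas : ∀ b ∈ U, AEStronglyMeasurable (K b) μ)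
    (hdiff : ∀ᵐ t ∂μ, DifferentiableOn ℂ (K · t) U) {g : α → ℝ} (hg : Integrable g μ)
    (hbound : ∀ᵐ t ∂μ, ∀ b ∈ U, ‖K b t‖ ≤ g t) :
    DifferentiableAt ℂ (fun b => ∫ t, K b t ∂μ) b₀ := by
  obtain ⟨ε, hε, hball⟩ := Metric.mem_nhds_iff.1 hU
  have hsub : ∀ x ∈ Metric.ball b₀ (ε / 2), Metric.ball x (ε / 2) ⊆ U := fun x hx =>
    (Metric.ball_subset_ball' (by rw [Metric.mem_ball] at hx; linarith)).trans hball
  have hdiffAt : ∀ᵐ t ∂μ, ∀ x ∈ Metric.ball b₀ (ε / 2), DifferentiableAt ℂ (K · t) x := by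
    filter_upwards [hdiff] with t ht x hx
    exact ht.differentiableAt (mem_of_superset (Metric.ball_mem_nhds x (half_pos hε)) (hsub x hx))
  have hmeas' : ∀ᶠ b in 𝓝 b₀, AEStronglyMeasurable (K b) μ := mem_of_superset hU hmeas
  refine (hasFDerivAt_integral_of_dominated_of_fderiv_le (𝕜 := ℂ)
    (F' := fun b t => fderiv ℂ (K · t) b) (bound := fun t => 2 * g t / (ε / 2))
    (Metric.ball_mem_nhds b₀ (half_pos hε)) hmeas' ?_ ?_ ?_
    ((hg.const_mul 2).div_const _) ?_).differentiableAt
  · exact hg.mono' hmeas'.self_of_nhds (hbound.mono fun t ht => ht b₀ (mem_of_mem_nhds hU))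
  · exact aestronglyMeasurable_fderiv_param hmeas'
      (hdiffAt.mono fun t ht => ht b₀ (Metric.mem_ball_self (half_pos hε)))
  · filter_upwards [hdiff, hbound] with t ht hgt x hx
    exact norm_fderiv_le_of_forall_ball_norm_le (half_pos hε) (ht.mono (hsub x hx))
      fun y hy => hgt y (hsub x hx hy)
  · exact hdiffAt.mono fun t ht x hx => (ht x hx).hasFDerivAt

theorem differentiableOn_setIntegral_mul [FiniteDimensional ℂ E] [TopologicalSpace α]
    [OpensMeasurableSpace α] {S : Set α} (hS : IsCompact S) (hSm : MeasurableSet S) {M : α → ℂ}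
    (hM : IntegrableOn M S μ) {V : Set E} (hV : IsOpen V) {H : E → α → ℂ}
    (hH : ∀ x ∈ S, DifferentiableOn ℂ (H · x) V)
    (hc : ContinuousOn (fun p : E × α => H p.1 p.2) (V ×ˢ S)) :
    DifferentiableOn ℂ (fun b => ∫ x in S, M x * H b x ∂μ) V := fun b₀ hb₀ => by
  have := FiniteDimensional.proper ℂ E
  obtain ⟨ε, hε, hball⟩ := Metric.nhds_basis_closedBall.mem_iff.1 (hV.mem_nhds hb₀)
  obtain ⟨C, hC⟩ := ((isCompact_closedBall b₀ ε).prod hS).exists_bound_of_continuousOn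
    (hc.mono (prod_mono_left hball))
  refine (differentiableAt_integral_of_dominated (Metric.closedBall_mem_nhds b₀ hε)
    (fun b hb => hM.aestronglyMeasurable.mul
      (ContinuousOn.aestronglyMeasurable (hc.uncurry_left b (hball hb)) hSm))
    ?_ (hM.norm.mul_const C) ?_).differentiableWithinAt
  · filter_upwards [ae_restrict_mem hSm] with x hx
    exact ((hH x hx).mono hball).const_mul _
  · filter_upwards [ae_restrict_mem hSm] with x hx b hb
    exact (norm_mul _ _).trans_le (mul_le_mul_of_nonneg_left (hC (b, x) ⟨hb, hx⟩) (norm_nonneg _))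

variable [CompleteSpace F]

theorem eq_of_eventually_eq_real_line {B : Set E} (hB : IsOpen B) (hc : Convex ℝ B) {f g : E → F}
    (hf : DifferentiableOn ℂ f B) (hg : DifferentiableOn ℂ g B) {w v : E} (hw : w ∈ B)
    (hfg : ∀ᶠ t : ℝ in 𝓝 0, f (w + (t : ℂ) • v) = g (w + (t : ℂ) • v)) {z : ℂ}
    (hz : w + z • v ∈ B) : f (w + z • v) = g (w + z • v) := by
  set S : Set ℂ := (fun z : ℂ => w + z • v) ⁻¹' B
  have hS : IsOpen S := hB.preimage (by fun_prop)
  have hSc : Convex ℝ S := (hc.translate_preimage_right w).linear_preimage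
    ((LinearMap.toSpanSingleton ℂ E v).restrictScalars ℝ)
  have hline : ∀ {f : E → F}, DifferentiableOn ℂ f B →
      AnalyticOnNhd ℂ (fun z : ℂ => f (w + z • v)) S := fun hf =>
    (hf.comp (s := S) (f := fun z : ℂ => w + z • v) (by fun_prop) fun z hz => hz).analyticOnNhd hS
  have h0 : (0 : ℂ) ∈ S := by simpa [S] using hw
  refine (hline hf).eqOn_of_preconnected_of_frequently_eq (hline hg) hSc.isPreconnected h0 ?_ hz
  have hreal : Tendsto (fun t : ℝ => (t : ℂ)) (𝓝[≠] 0) (𝓝[≠] 0) :=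
    Complex.continuous_ofReal.continuousWithinAt.tendsto_nhdsWithin fun t ht => by simpa using ht
  exact hreal.frequently (hfg.filter_mono nhdsWithin_le_nhds).frequently

theorem eqOn_of_isPreconnected_of_eventuallyEq {V : Set E} (hV : IsOpen V) (hVc : IsPreconnected V)
    {f g : E → F} (hf : DifferentiableOn ℂ f V) (hg : DifferentiableOn ℂ g V) {b₀ : E}
    (hb₀ : b₀ ∈ V) (hfg : f =ᶠ[𝓝 b₀] g) : EqOn f g V := by
  set W : Set E := {b | f =ᶠ[𝓝 b] g}
  suffices h : V ⊆ W from fun b hb => (h hb).self_of_nhds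
  refine hVc.subset_of_closure_inter_subset isOpen_setOfPred_eventually_nhds ⟨b₀, hb₀, hfg⟩ ?_
  rintro b ⟨hbW, hbV⟩
  obtain ⟨ε, hε, hball⟩ := Metric.isOpen_iff.1 hV b hbV
  obtain ⟨w, hw, hwb⟩ := Metric.mem_closure_iff.1 hbW ε hε
  filter_upwards [Metric.ball_mem_nhds _ hε] with z hz
  have hline : Continuous fun t : ℝ => w + (t : ℂ) • (z - w) := by fun_prop
  simpa using eq_of_eventually_eq_real_line Metric.isOpen_ball (convex_ball b ε)
    (hf.mono hball) (hg.mono hball) (Metric.mem_ball'.2 hwb)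
    ((hline.tendsto' 0 w (by simp)).eventually hw) (z := 1) (by simpa using hz)

theorem eventuallyEq_of_eventually_eq_ofReal {ι : Type*} [Finite ι] {V : Set (ι → ℂ)}
    {b₀ : ι → ℝ} (hV : V ∈ 𝓝 fun i => (b₀ i : ℂ)) {f g : (ι → ℂ) → F}
    (hf : DifferentiableOn ℂ f V) (hg : DifferentiableOn ℂ g V)
    (hfg : ∀ᶠ b : ι → ℝ in 𝓝 b₀, f (fun i => (b i : ℂ)) = g fun i => (b i : ℂ)) :
    f =ᶠ[𝓝 fun i => (b₀ i : ℂ)] g := by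
  have := Fintype.ofFinite ι
  obtain ⟨ε, hε, hball⟩ := Metric.mem_nhds_iff.1 hV
  set B : Set (ι → ℂ) := Metric.ball (fun i => (b₀ i : ℂ)) ε
  have hB : B ∈ 𝓝 fun i => (b₀ i : ℂ) := Metric.ball_mem_nhds _ hε
  have hre : Continuous fun b : ι → ℂ => fun i => (b i).re := by fun_prop
  have hcast : Continuous fun b : ι → ℝ => fun i => (b i : ℂ) := by fun_prop
  have hre₀ := hre.tendsto' (fun i => (b₀ i : ℂ)) b₀ (by simp)
  filter_upwards [hB, hre₀.eventually hfg.eventually_nhds,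
    hre₀.eventually ((hcast.tendsto b₀).eventually hB)] with b hb hbre hbB
  have hb_eq : (fun i => ((b i).re : ℂ)) + Complex.I • (fun i => ((b i).im : ℂ)) = b := by
    ext i
    simp [mul_comm Complex.I]
  have hline : Continuous fun t : ℝ => fun i => (b i).re + t * (b i).im := by fun_prop
  rw [← hb_eq]
  refine eq_of_eventually_eq_real_line Metric.isOpen_ball (convex_ball _ _) (hf.mono hball)
    (hg.mono hball) hbB ?_ (hb_eq.symm ▸ hb)
  filter_upwards [(hline.tendsto' 0 (fun i => (b i).re) (by simp)).eventually hbre] with t ht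
  convert ht using 2 <;> · ext i; simp

theorem eqOn_of_eventually_eq_ofReal {ι : Type*} [Finite ι] {V : Set (ι → ℂ)} (hV : IsOpen V)
    (hVc : IsPreconnected V) {f g : (ι → ℂ) → F} (hf : DifferentiableOn ℂ f V)
    (hg : DifferentiableOn ℂ g V) {b₀ : ι → ℝ} (hb₀ : (fun i => (b₀ i : ℂ)) ∈ V)
    (hfg : ∀ᶠ b : ι → ℝ in 𝓝 b₀, f (fun i => (b i : ℂ)) = g fun i => (b i : ℂ)) :
    EqOn f g V := by
  have := Fintype.ofFinite ι
  exact eqOn_of_isPreconnected_of_eventuallyEq hV hVc hf hg hb₀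
    (eventuallyEq_of_eventually_eq_ofReal (hV.mem_nhds hb₀) hf hg hfg)

end Holomorphy

section ContinuationRegion

variable {s : ℕ}

theorem IsAnalyticContinuation.eqOn {V : Set (Fin s → ℂ)} (hV : IsContinuationRegion V)
    {F₀ : (Fin s → ℝ) → ℂ} {F G : (Fin s → ℂ) → ℂ} (hF : IsAnalyticContinuation V F₀ F)
    (hG : IsAnalyticContinuation V F₀ G) : EqOn F G V := by
  refine eqOn_of_eventually_eq_ofReal hV.1 hV.2.1 hF.1 hG.1 (b₀ := fun _ => 1)
    (hV.2.2 _ fun _ => one_pos) ?_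
  have hpos : ∀ᶠ b : Fin s → ℝ in 𝓝 fun _ => 1, ∀ i, 0 < b i :=
    eventually_all.2 fun i => (continuous_apply i).continuousAt.eventually (lt_mem_nhds one_pos)
  filter_upwards [hpos] with b hb
  rw [hF.2 b hb, hG.2 b hb]

theorem isClosed_range_neg_natCast : IsClosed (range fun k : ℕ => -(k : ℂ)) := by
  have hemb := Complex.isometry_ofReal.isClosedEmbedding.comp Nat.isClosedEmbedding_coe_real
  simpa [range, Function.comp_def] using
    ((Homeomorph.neg ℂ).isClosedEmbedding.comp hemb).isClosed_range

theorem isPreconnected_compl_range_neg_natCast :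
    IsPreconnected (range fun k : ℕ => -(k : ℂ))ᶜ :=
  ((countable_range _).isPathConnected_compl_of_one_lt_rank
    (by rw [Complex.rank_real_complex]; norm_num)).isConnected.isPreconnected

theorem regularParams_eq_preimage :
    regularParams s = (fun b => ∑ i, b i) ⁻¹' (range fun k : ℕ => -(k : ℂ))ᶜ := by
  ext b
  simp only [regularParams, mem_ofPred_eq, mem_preimage, mem_compl_iff, mem_range,
    not_exists, eq_comm (a := ∑ i, b i), ne_eq]

theorem isOpen_regularParams : IsOpen (regularParams s) := by
  rw [regularParams_eq_preimage]
  exact isClosed_range_neg_natCast.isOpen_compl.preimage (by fun_prop)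

theorem isPreconnected_regularParams : IsPreconnected (regularParams (s + 1)) := by
  -- Coordinates: the sum `p.1` and the vector `p.2`, whose first entry is corrected.
  have himage : regularParams (s + 1) =
      (fun p : ℂ × (Fin (s + 1) → ℂ) => p.2 + Pi.single 0 (p.1 - ∑ i, p.2 i)) ''
        ((range fun k : ℕ => -(k : ℂ))ᶜ ×ˢ univ) := by
    rw [regularParams_eq_preimage]
    ext b
    constructor
    · intro hb
      exact ⟨(∑ i, b i, b), ⟨hb, mem_univ _⟩, by simp⟩
    · rintro ⟨⟨w, a⟩, ⟨hw, -⟩, rfl⟩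
      simpa [Finset.sum_add_distrib] using hw
  rw [himage]
  refine (isPreconnected_compl_range_neg_natCast.prod isPreconnected_univ).image _
    (Continuous.continuousOn ?_)
  exact continuous_snd.add ((continuous_single 0).comp (by fun_prop))

theorem ofReal_mem_regularParams {b : Fin (s + 1) → ℝ} (hb : ∀ i, 0 < b i) :
    (fun i => (b i : ℂ)) ∈ regularParams (s + 1) := by
  intro k hk
  have hsum : 0 < ∑ i, b i := Finset.sum_pos (fun i _ => hb i) Finset.univ_nonempty
  have hre : ∑ i, b i = -(k : ℝ) := by simpa using congrArg Complex.re hk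
  linarith [k.cast_nonneg (α := ℝ)]

theorem isContinuationRegion_regularParams :
    IsContinuationRegion (regularParams (s + 1)) :=
  ⟨isOpen_regularParams, isPreconnected_regularParams, fun _ hb => ofReal_mem_regularParams hb⟩

end ContinuationRegion

section Simplex

theorem measurePreserving_reflection {E : Type*} [NormedAddCommGroup E] [NormedSpace ℝ E]
    [FiniteDimensional ℝ E] [MeasurableSpace E] [BorelSpace E] (μ : Measure E)
    [μ.IsAddHaarMeasure] {x : E} {φ : Module.Dual ℝ E} (h : φ x = 2) :
    MeasurePreserving (Module.reflection h) μ μ := by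
  set f : E →ₗ[ℝ] E := (Module.reflection h).toLinearMap
  have hff : f ∘ₗ f = LinearMap.id := LinearMap.ext (Module.involutive_reflection h)
  have hdet : LinearMap.det f * LinearMap.det f = 1 := by
    rw [← LinearMap.det_comp, hff, LinearMap.det_id]
  have habs : |(LinearMap.det f)⁻¹| = 1 := by
    rcases mul_self_eq_one_iff.1 hdet with h | h <;> simp [h]
  refine ⟨(LinearMap.continuous_of_finiteDimensional f).measurable, ?_⟩
  have hmap := Measure.map_linearMap_addHaar_eq_smul_addHaar μ (left_ne_zero_of_mul_eq_one hdet)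
  rwa [habs, ENNReal.ofReal_one, one_smul] at hmap

variable {m : ℕ}

@[simp] theorem baryWeights_zero (t : Fin m → ℝ) : baryWeights t 0 = 1 - ∑ j, t j := rfl

@[simp] theorem baryWeights_succ (t : Fin m → ℝ) (j : Fin m) : baryWeights t j.succ = t j := rfl

theorem sum_baryWeights (t : Fin m → ℝ) : ∑ i, baryWeights t i = 1 := by
  simp [Fin.sum_univ_succ]

theorem baryWeights_injective : Function.Injective (baryWeights (m := m)) := fun _ _ h =>
  funext fun j => congrFun h j.succ

theorem mem_stdSimplexE_iff {t : Fin m → ℝ} : t ∈ stdSimplexE m ↔ ∀ i, 0 ≤ baryWeights t i := by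
  simp only [stdSimplexE, mem_ofPred_eq, Fin.forall_fin_succ, baryWeights_zero, baryWeights_succ,
    sub_nonneg]
  exact and_comm

theorem baryWeights_le_one {t : Fin m → ℝ} (ht : t ∈ stdSimplexE m) (i : Fin (m + 1)) :
    baryWeights t i ≤ 1 := by
  rw [← sum_baryWeights t]
  exact Finset.single_le_sum (fun j _ => mem_stdSimplexE_iff.1 ht j) (Finset.mem_univ i)

theorem exists_inv_le_baryWeights (t : Fin m → ℝ) : ∃ i, ((m : ℝ) + 1)⁻¹ ≤ baryWeights t i := by
  have hsum : ∑ _i : Fin (m + 1), ((m : ℝ) + 1)⁻¹ ≤ ∑ i, baryWeights t i := by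
    rw [sum_baryWeights, Finset.sum_const, Finset.card_univ, Fintype.card_fin, nsmul_eq_mul,
      Nat.cast_add_one, mul_inv_cancel₀ (by positivity)]
  simpa using Finset.exists_le_of_sum_le Finset.univ_nonempty hsum

theorem contDiff_baryWeights {k : WithTop ℕ∞} (i : Fin (m + 1)) :
    ContDiff ℝ k fun t : Fin m → ℝ => baryWeights t i := by
  refine Fin.cases ?_ (fun j => ?_) i
  · simp only [baryWeights_zero]
    fun_prop
  · simp only [baryWeights_succ]
    fun_prop

@[fun_prop]
theorem continuous_baryWeights (i : Fin (m + 1)) :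
    Continuous fun t : Fin m → ℝ => baryWeights t i :=
  (contDiff_baryWeights (k := 0) i).continuous

theorem isClosed_stdSimplexE : IsClosed (stdSimplexE m) := by
  have hinter : stdSimplexE m = ⋂ i, {t | 0 ≤ baryWeights t i} := by
    ext t
    simp [mem_stdSimplexE_iff]
  rw [hinter]
  exact isClosed_iInter fun i => isClosed_le continuous_const (by fun_prop)

theorem stdSimplexE_subset_Icc : stdSimplexE m ⊆ univ.pi fun _ => Icc (0 : ℝ) 1 := fun t ht j _ =>
  ⟨ht.1 j, by simpa using baryWeights_le_one ht j.succ⟩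

theorem isCompact_stdSimplexE : IsCompact (stdSimplexE m) :=
  (isCompact_univ_pi fun _ => isCompact_Icc).of_isClosed_subset isClosed_stdSimplexE
    stdSimplexE_subset_Icc

theorem measurableSet_stdSimplexE : MeasurableSet (stdSimplexE m) :=
  isClosed_stdSimplexE.measurableSet

/-- The affine involution of `ℝ^m` which exchanges the barycentric weights `0` and `k + 1`. It
carries statements about the coordinates `t_1, …, t_m` over to `t_0 = 1 - t_1 - ⋯ - t_m`. -/
def barySwap (k : Fin m) (t : Fin m → ℝ) : Fin m → ℝ :=
  Function.update t k (1 - ∑ j, t j)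

theorem baryWeights_barySwap (k : Fin m) (t : Fin m → ℝ) (i : Fin (m + 1)) :
    baryWeights (barySwap k t) i = baryWeights t (Equiv.swap 0 k.succ i) := by
  refine Fin.cases ?_ (fun j => ?_) i
  · rw [Equiv.swap_apply_left, baryWeights_zero, baryWeights_succ, barySwap,
      Finset.sum_update_of_mem (Finset.mem_univ k), Finset.sum_sdiff_eq_sub (Finset.subset_univ _),
      Finset.sum_singleton]
    ring
  · rw [baryWeights_succ, barySwap]
    by_cases h : j = k
    · subst h; simp
    · rw [Function.update_of_ne h, Equiv.swap_apply_of_ne_of_ne (Fin.succ_ne_zero j)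
        (fun h' => h (Fin.succ_injective _ h')), baryWeights_succ]

theorem barySwap_involutive (k : Fin m) : Function.Involutive (barySwap k) := fun t =>
  baryWeights_injective <| funext fun i => by
    rw [baryWeights_barySwap, baryWeights_barySwap, Equiv.swap_apply_self]

theorem barySwap_mem_stdSimplexE {k : Fin m} {t : Fin m → ℝ} :
    barySwap k t ∈ stdSimplexE m ↔ t ∈ stdSimplexE m := by
  simp only [mem_stdSimplexE_iff, baryWeights_barySwap]
  exact (Equiv.swap 0 k.succ).forall_congr_right (q := fun i => 0 ≤ baryWeights t i)

theorem measurableEmbedding_barySwap (k : Fin m) : MeasurableEmbedding (barySwap k) := by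
  have hcont : Continuous (barySwap k) := by
    unfold barySwap
    fun_prop
  exact (Homeomorph.mk (barySwap_involutive k).toPerm hcont hcont).measurableEmbedding

theorem measurePreserving_barySwap (k : Fin m) : MeasurePreserving (barySwap k) := by
  let φ : Module.Dual ℝ (Fin m → ℝ) :=
    LinearMap.proj k + ∑ j : Fin m, (LinearMap.proj j : Module.Dual ℝ (Fin m → ℝ))
  have hφ : φ (Pi.single k 1) = 2 := by
    simp [φ]
    norm_num
  have heq : barySwap k = (Pi.single k 1 + ·) ∘ Module.reflection hφ := by
    funext t j
    rcases eq_or_ne j k with rfl | h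
    · simp [barySwap, Module.reflection_apply, φ]
      ring
    · simp [barySwap, Module.reflection_apply, h]
  rw [heq]
  exact (measurePreserving_add_left volume _).comp (measurePreserving_reflection volume hφ)

theorem ae_baryWeights_ne_zero (i : Fin (m + 1)) :
    ∀ᵐ t : Fin m → ℝ, baryWeights t i ≠ 0 := by
  have hsucc : ∀ j : Fin m, ∀ᵐ t : Fin m → ℝ, baryWeights t j.succ ≠ 0 := fun j => by
    rw [ae_iff]
    simpa [volume_pi] using Measure.pi_hyperplane (fun _ : Fin m => (volume : Measure ℝ)) j 0
  refine Fin.cases ?_ hsucc i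
  rcases m with _ | m
  · exact Eventually.of_forall fun t => by simp
  · filter_upwards [(measurePreserving_barySwap 0).quasiMeasurePreserving.ae (hsucc 0)] with t ht
    rwa [baryWeights_barySwap, Equiv.swap_apply_right] at ht

theorem ae_stdSimplexE_baryWeights_mem_Ioc :
    ∀ᵐ t ∂(volume.restrict (stdSimplexE m)), ∀ i, baryWeights t i ∈ Ioc (0 : ℝ) 1 := by
  filter_upwards [ae_restrict_mem measurableSet_stdSimplexE,
    ae_restrict_of_ae (ae_all_iff.2 (ae_baryWeights_ne_zero (m := m)))] with t ht h0 i
  exact ⟨lt_of_le_of_ne (mem_stdSimplexE_iff.1 ht i) (h0 i).symm, baryWeights_le_one ht i⟩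

theorem integrableOn_prod_rpow_Icc {ι : Type*} [Fintype ι] {b : ι → ℝ} (hb : ∀ j, 0 < b j) :
    IntegrableOn (fun t : ι → ℝ => ∏ j, t j ^ (b j - 1)) (univ.pi fun _ => Icc (0 : ℝ) 1) := by
  rw [IntegrableOn, volume_pi, Measure.restrict_pi_pi]
  refine Integrable.fintype_prod (f := fun j (x : ℝ) => x ^ (b j - 1)) fun j => ?_
  rw [← IntegrableOn, integrableOn_Icc_iff_integrableOn_Ioc,
    ← intervalIntegrable_iff_integrableOn_Ioc_of_le zero_le_one]
  exact intervalIntegral.intervalIntegrable_rpow' (by linarith [hb j])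

theorem integrableOn_prod_rpow_of_le_baryWeights_zero {b : Fin (m + 1) → ℝ}
    (hb : ∀ j : Fin m, 0 < b j.succ) {a : ℝ} (ha : 0 < a) :
    IntegrableOn (fun t => ∏ i, baryWeights t i ^ (b i - 1))
      (stdSimplexE m ∩ {t | a ≤ baryWeights t 0}) := by
  have hcompact : IsCompact (stdSimplexE m ∩ {t | a ≤ baryWeights t 0}) :=
    isCompact_stdSimplexE.inter_right (isClosed_le continuous_const (by fun_prop))
  have hcont : ContinuousOn (fun t : Fin m → ℝ => baryWeights t 0 ^ (b 0 - 1))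
      (stdSimplexE m ∩ {t | a ≤ baryWeights t 0}) :=
    (continuous_baryWeights 0).continuousOn.rpow_const fun t ht => Or.inl (ha.trans_le ht.2).ne'
  simpa only [Fin.prod_univ_succ, baryWeights_succ] using
    ((integrableOn_prod_rpow_Icc hb).mono_set
      (inter_subset_left.trans stdSimplexE_subset_Icc)).continuousOn_mul hcont hcompact

theorem integrableOn_prod_rpow_of_le_baryWeights {b : Fin (m + 1) → ℝ} (hb : ∀ i, 0 < b i)
    {a : ℝ} (ha : 0 < a) (i : Fin (m + 1)) :
    IntegrableOn (fun t => ∏ i, baryWeights t i ^ (b i - 1))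
      (stdSimplexE m ∩ {t | a ≤ baryWeights t i}) := by
  refine Fin.cases (integrableOn_prod_rpow_of_le_baryWeights_zero (fun j => hb _) ha)
    (fun k => ?_) i
  have hset : barySwap k ⁻¹' (stdSimplexE m ∩ {t | a ≤ baryWeights t k.succ}) =
      stdSimplexE m ∩ {t | a ≤ baryWeights t 0} := by
    ext t
    simp only [mem_inter_iff, mem_preimage, barySwap_mem_stdSimplexE, mem_ofPred_eq,
      baryWeights_barySwap, Equiv.swap_apply_right]
  rw [← (measurePreserving_barySwap k).integrableOn_comp_preimage
    (measurableEmbedding_barySwap k), hset]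
  refine (integrableOn_prod_rpow_of_le_baryWeights_zero
    (b := b ∘ Equiv.swap 0 k.succ) (fun j => hb _) ha).congr_fun (fun t _ => ?_) ?_
  · simp only [Function.comp, baryWeights_barySwap]
    rw [← Equiv.prod_comp (Equiv.swap 0 k.succ)]
    simp only [Equiv.swap_apply_self]
  · exact measurableSet_stdSimplexE.inter (measurableSet_le measurable_const (by fun_prop))

-- The integrand is singular where weights vanish, but some weight is always at least `1 / (m + 1)`.
theorem integrableOn_prod_rpow_stdSimplexE {b : Fin (m + 1) → ℝ} (hb : ∀ i, 0 < b i) :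
    IntegrableOn (fun t => ∏ i, baryWeights t i ^ (b i - 1)) (stdSimplexE m) := by
  refine (integrableOn_finite_iUnion.2
    (integrableOn_prod_rpow_of_le_baryWeights hb (a := ((m : ℝ) + 1)⁻¹)
      (by positivity))).mono_set fun t ht => ?_
  exact mem_iUnion.2 ((exists_inv_le_baryWeights t).imp fun i hi => ⟨ht, hi⟩)

theorem dirichletDensity_eq (b : Fin (m + 1) → ℝ) (t : Fin m → ℝ) :
    dirichletDensity b t = Real.Gamma (∑ i, b i) * (∏ i, (Real.Gamma (b i))⁻¹) *
      ∏ i, baryWeights t i ^ (b i - 1) := by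
  rw [dirichletDensity, Finset.prod_mul_distrib, mul_assoc]

theorem integrableOn_dirichletDensity {b : Fin (m + 1) → ℝ} (hb : ∀ i, 0 < b i) :
    IntegrableOn (dirichletDensity b) (stdSimplexE m) := by
  rw [funext (dirichletDensity_eq b)]
  exact (integrableOn_prod_rpow_stdSimplexE hb).const_mul _

theorem dirichletDensity_nonneg {b : Fin (m + 1) → ℝ} (hb : ∀ i, 0 < b i) {t : Fin m → ℝ}
    (ht : t ∈ stdSimplexE m) : 0 ≤ dirichletDensity b t := by
  refine mul_nonneg (Real.Gamma_nonneg_of_nonneg (Finset.sum_nonneg fun i _ => (hb i).le))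
    (Finset.prod_nonneg fun i _ => mul_nonneg (inv_nonneg.2 (Real.Gamma_nonneg_of_nonneg
      (hb i).le)) (Real.rpow_nonneg (mem_stdSimplexE_iff.1 ht i) _))

end Simplex

section ReducedAverage

/-- The half space of the parameter vectors with `Re b_i > -T_i` for every `i`. The averages are
defined by convergent integrals for `T = 0`, and are continued to larger and larger `T`. -/
def paramHalfSpace {ι : Type*} (T : ι → ℝ) : Set (ι → ℂ) :=
  {b | ∀ i, -T i < (b i).re}

theorem paramHalfSpace_eq_pi {ι : Type*} (T : ι → ℝ) :
    paramHalfSpace T = univ.pi fun i => {z : ℂ | -T i < z.re} := by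
  ext b
  simp [paramHalfSpace]

theorem isOpen_paramHalfSpace {ι : Type*} [Finite ι] (T : ι → ℝ) : IsOpen (paramHalfSpace T) := by
  rw [paramHalfSpace_eq_pi]
  exact isOpen_set_pi finite_univ fun i _ => isOpen_lt continuous_const Complex.continuous_re

theorem convex_paramHalfSpace {ι : Type*} (T : ι → ℝ) : Convex ℝ (paramHalfSpace T) := by
  rw [paramHalfSpace_eq_pi]
  exact convex_pi fun i _ => convex_halfSpace_re_gt _

theorem ofReal_mem_paramHalfSpace {ι : Type*} {T b : ι → ℝ} (hT : ∀ i, 0 ≤ T i)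
    (hb : ∀ i, 0 < b i) : (fun i => (b i : ℂ)) ∈ paramHalfSpace T := fun i => by
  simpa using (neg_nonpos.2 (hT i)).trans_lt (hb i)

theorem exists_pos_two_mul_le_re {ι : Type*} [Finite ι] [Nonempty ι] {b₀ : ι → ℂ}
    (hb₀ : b₀ ∈ paramHalfSpace 0) : ∃ ε > 0, ∀ i, 2 * ε ≤ (b₀ i).re := by
  obtain ⟨i₀, hi₀⟩ := Finite.exists_min fun i => (b₀ i).re
  have hpos : 0 < (b₀ i₀).re := by simpa using hb₀ i₀
  exact ⟨(b₀ i₀).re / 2, by positivity, fun i => by linarith [hi₀ i]⟩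

theorem norm_prod_cpow_le_of_mem_ball {ι : Type*} [Fintype ι] {b₀ b : ι → ℂ} {ε : ℝ}
    (hε : ∀ i, 2 * ε ≤ (b₀ i).re) (hb : b ∈ Metric.ball b₀ ε) {u : ι → ℝ}
    (hu : ∀ i, u i ∈ Ioc (0 : ℝ) 1) :
    ‖∏ i, (u i : ℂ) ^ (b i - 1)‖ ≤ ∏ i, u i ^ (ε - 1) := by
  rw [norm_prod]
  refine Finset.prod_le_prod (fun i _ => norm_nonneg _) fun i _ => ?_
  rw [Complex.norm_cpow_eq_rpow_re_of_pos (hu i).1]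
  refine Real.rpow_le_rpow_of_exponent_ge (hu i).1 (hu i).2 ?_
  have hdist : ‖b i - b₀ i‖ < ε := by
    rw [← Complex.dist_eq]
    exact (dist_le_pi_dist b b₀ i).trans_lt hb
  have hre := (abs_lt.1 ((Complex.abs_re_le_norm _).trans_lt hdist)).1
  simp only [Complex.sub_re, Complex.one_re] at hre ⊢
  linarith [hε i]

theorem differentiable_prod_apply {ι : Type*} [Fintype ι] {E : Type*} [NormedAddCommGroup E]
    [NormedSpace ℂ E] {f : ι → E → ℂ} (hf : ∀ i, Differentiable ℂ (f i)) :
    Differentiable ℂ fun x => ∏ i, f i x := fun x => by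
  classical
  exact (HasFDerivAt.finsetProd fun i _ => (hf i x).hasFDerivAt).differentiableAt

theorem differentiable_prod_cpow {ι : Type*} [Fintype ι] {u : ι → ℝ} (hu : ∀ i, 0 < u i) :
    Differentiable ℂ fun b : ι → ℂ => ∏ i, (u i : ℂ) ^ (b i - 1) :=
  differentiable_prod_apply fun i => Differentiable.const_cpow (by fun_prop)
    (Or.inl (Complex.ofReal_ne_zero.2 (hu i).ne'))

theorem differentiable_prod_inv_Gamma {ι : Type*} [Fintype ι] :
    Differentiable ℂ fun b : ι → ℂ => ∏ i, (Complex.Gamma (b i))⁻¹ :=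
  differentiable_prod_apply fun i =>
    Complex.differentiable_one_div_Gamma.comp (differentiable_apply i)

theorem ofReal_prod_rpow {ι : Type*} [Fintype ι] {u : ι → ℝ} (hu : ∀ i, 0 ≤ u i) (b : ι → ℝ) :
    ((∏ i, u i ^ (b i - 1) : ℝ) : ℂ) = ∏ i, (u i : ℂ) ^ ((b i : ℂ) - 1) := by
  rw [Complex.ofReal_prod]
  refine Finset.prod_congr rfl fun i _ => ?_
  rw [Complex.ofReal_cpow (hu i), Complex.ofReal_sub, Complex.ofReal_one]

variable {m : ℕ}

/-- The unnormalised Dirichlet average `∫_{E_m} h(∑ u_i z_i) ∏ u_i ^ (b_i - 1) du` with complex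
parameters. -/
noncomputable def simplexIntegral (h : ℝ → ℂ) (b : Fin (m + 1) → ℂ) (z : Fin (m + 1) → ℝ) : ℂ :=
  ∫ t in stdSimplexE m, h (∑ i, baryWeights t i * z i) * ∏ i, (baryWeights t i : ℂ) ^ (b i - 1)

/-- The Dirichlet average of `h` divided by `Γ(∑ b_i)`. For smooth `h` it continues, in contrast to
the Dirichlet average itself, to an entire function of `b`. -/
noncomputable def reducedAverage (h : ℝ → ℂ) (b : Fin (m + 1) → ℂ) (z : Fin (m + 1) → ℝ) : ℂ :=
  (∏ i, (Complex.Gamma (b i))⁻¹) * simplexIntegral h b z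

theorem dirichletAverage_eq (h : ℝ → ℂ) (b : Fin (m + 1) → ℝ) (z : Fin (m + 1) → ℝ) :
    dirichletAverage h b z =
      Complex.Gamma (∑ i, (b i : ℂ)) * reducedAverage h (fun i => (b i : ℂ)) z := by
  rw [reducedAverage, simplexIntegral, dirichletAverage, ← mul_assoc, ← integral_const_mul]
  refine setIntegral_congr_fun measurableSet_stdSimplexE fun t ht => ?_
  simp only [dirichletDensity_eq]
  rw [Complex.ofReal_mul, ofReal_prod_rpow (mem_stdSimplexE_iff.1 ht), Complex.ofReal_mul,
    Complex.ofReal_prod, ← Complex.ofReal_sum, Complex.Gamma_ofReal]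
  simp only [Complex.ofReal_inv, Complex.Gamma_ofReal]
  ring

theorem aestronglyMeasurable_simplexIntegrand {h : ℝ → ℂ} (hh : Continuous h)
    (b : Fin (m + 1) → ℂ) (z : Fin (m + 1) → ℝ) :
    AEStronglyMeasurable (fun t => h (∑ i, baryWeights t i * z i) *
      ∏ i, (baryWeights t i : ℂ) ^ (b i - 1)) (volume.restrict (stdSimplexE m)) := by
  refine AEStronglyMeasurable.mul (Continuous.aestronglyMeasurable (by fun_prop)) ?_
  refine (Finset.measurable_fun_prod _ fun i _ => Measurable.pow_const ?_ _).aestronglyMeasurable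
  exact (Complex.continuous_ofReal.comp (continuous_baryWeights i)).measurable

theorem exists_integrableOn_simplexIntegrand_bound {h : ℝ → ℂ} (hh : Continuous h)
    {Z : Set (Fin (m + 1) → ℝ)} (hZ : IsCompact Z) {b₀ : Fin (m + 1) → ℂ}
    (hb₀ : b₀ ∈ paramHalfSpace 0) :
    ∃ U ∈ 𝓝 b₀, ∃ g : (Fin m → ℝ) → ℝ, IntegrableOn g (stdSimplexE m) ∧
      ∀ᵐ t ∂volume.restrict (stdSimplexE m), ∀ b ∈ U, ∀ z ∈ Z,
        ‖h (∑ i, baryWeights t i * z i) * ∏ i, (baryWeights t i : ℂ) ^ (b i - 1)‖ ≤ g t := by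
  obtain ⟨ε, hε, hεb⟩ := exists_pos_two_mul_le_re hb₀
  have hcont : Continuous fun p : (Fin (m + 1) → ℝ) × (Fin m → ℝ) =>
      h (∑ i, baryWeights p.2 i * p.1 i) := by fun_prop
  obtain ⟨C, hC⟩ :=
    (hZ.prod isCompact_stdSimplexE).exists_bound_of_continuousOn hcont.continuousOn
  refine ⟨Metric.ball b₀ ε, Metric.ball_mem_nhds b₀ hε, fun t => C * ∏ i, baryWeights t i ^ (ε - 1),
    (integrableOn_prod_rpow_stdSimplexE (b := fun _ => ε) fun _ => hε).const_mul C, ?_⟩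
  filter_upwards [ae_restrict_mem measurableSet_stdSimplexE, ae_stdSimplexE_baryWeights_mem_Ioc]
    with t htE ht b hb z hz
  have hCt := hC (z, t) ⟨hz, htE⟩
  rw [norm_mul]
  exact mul_le_mul hCt (norm_prod_cpow_le_of_mem_ball hεb hb ht) (norm_nonneg _)
    ((norm_nonneg _).trans hCt)

theorem differentiableOn_reducedAverage {h : ℝ → ℂ} (hh : Continuous h) (z : Fin (m + 1) → ℝ) :
    DifferentiableOn ℂ (fun b => reducedAverage h b z) (paramHalfSpace 0) := by
  refine differentiable_prod_inv_Gamma.differentiableOn.mul fun b₀ hb₀ => ?_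
  obtain ⟨U, hU, g, hg, hbound⟩ :=
    exists_integrableOn_simplexIntegrand_bound hh (isCompact_singleton (x := z)) hb₀
  refine (differentiableAt_integral_of_dominated hU
    (fun b _ => aestronglyMeasurable_simplexIntegrand hh b z) ?_ hg
    (hbound.mono fun t ht b hb => ht b hb z rfl)).differentiableWithinAt
  filter_upwards [ae_stdSimplexE_baryWeights_mem_Ioc] with t ht
  exact ((differentiable_prod_cpow fun i => (ht i).1).const_mul _).differentiableOn

theorem continuousOn_reducedAverage {h : ℝ → ℂ} (hh : Continuous h) :
    ContinuousOn (fun p : (Fin (m + 1) → ℂ) × (Fin (m + 1) → ℝ) => reducedAverage h p.1 p.2)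
      (paramHalfSpace 0 ×ˢ univ) := by
  refine ContinuousOn.mul
    (differentiable_prod_inv_Gamma.continuous.comp continuous_fst).continuousOn ?_
  rintro ⟨b₀, z₀⟩ ⟨hb₀, -⟩
  obtain ⟨U, hU, g, hg, hbound⟩ :=
    exists_integrableOn_simplexIntegrand_bound hh (isCompact_closedBall z₀ 1) hb₀
  refine ContinuousAt.continuousWithinAt (continuousAt_of_dominated
    (Eventually.of_forall fun p => aestronglyMeasurable_simplexIntegrand hh p.1 p.2) ?_ hg ?_)
  · filter_upwards [prod_mem_nhds hU (Metric.closedBall_mem_nhds z₀ one_pos)] with p hp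
    exact hbound.mono fun t ht => ht p.1 hp.1 p.2 hp.2
  · filter_upwards [ae_stdSimplexE_baryWeights_mem_Ioc] with t ht
    have hpow : Continuous fun b : Fin (m + 1) → ℂ => ∏ i, (baryWeights t i : ℂ) ^ (b i - 1) :=
      (differentiable_prod_cpow fun i => (ht i).1).continuous
    exact Continuous.continuousAt (.mul (by fun_prop) (hpow.comp continuous_fst))

end ReducedAverage

section Recurrence

theorem prod_apply_add_single {ι A B : Type*} [Fintype ι] [DecidableEq ι] [AddZeroClass A]
    [CommMonoid B] (f : ι → A → B) (b : ι → A) (i : ι) (a : A) :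
    ∏ j, f j ((b + Pi.single i a : ι → A) j) =
      f i (b i + a) * ∏ j ∈ Finset.univ.erase i, f j (b j) := by
  rw [← Finset.mul_prod_erase Finset.univ _ (Finset.mem_univ i), Pi.add_apply, Pi.single_eq_same]
  congr 1
  refine Finset.prod_congr rfl fun j hj => ?_
  rw [Pi.add_apply, Pi.single_eq_of_ne (Finset.ne_of_mem_erase hj), add_zero]

theorem sum_mul_single_sub_single {ι : Type*} [Fintype ι] [DecidableEq ι] (f : ι → ℝ) (i k : ι) :
    ∑ j, f j * (Pi.single i 1 - Pi.single k 1 : ι → ℝ) j = f i - f k := by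
  simp [mul_sub, Finset.sum_sub_distrib, Pi.single_apply]

theorem ofReal_add_single {ι : Type*} [DecidableEq ι] (b : ι → ℝ) (i : ι) :
    (fun j => ((b + Pi.single i 1 : ι → ℝ) j : ℂ)) = (fun j => (b j : ℂ)) + Pi.single i 1 := by
  ext j
  rcases eq_or_ne j i with rfl | hj <;> simp [*]

theorem le_add_single {ι : Type*} [DecidableEq ι] (b : ι → ℝ) (i : ι) :
    b ≤ b + Pi.single i 1 :=
  le_add_of_nonneg_right (Pi.single_nonneg.2 zero_le_one)

theorem add_single_mem_paramHalfSpace {ι : Type*} [DecidableEq ι] {T : ι → ℝ} {b : ι → ℂ}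
    (hb : b ∈ paramHalfSpace T) (i : ι) : b + Pi.single i 1 ∈ paramHalfSpace T := fun j => by
  have hbj := hb j
  rcases eq_or_ne j i with rfl | hj
  · simpa using hbj.trans (lt_add_one _)
  · simpa [hj] using hbj

theorem hasDerivAt_max_zero_rpow {p : ℝ} (hp : 1 < p) (x : ℝ) :
    HasDerivAt (fun x : ℝ => max x 0 ^ p) (p * max x 0 ^ (p - 1)) x := by
  have hp0 : p ≠ 0 := by positivity
  have hp1 : p - 1 ≠ 0 := by linarith
  have hIci : ∀ x ≥ 0, HasDerivWithinAt (fun x : ℝ => max x 0 ^ p) (p * max x 0 ^ (p - 1))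
      (Ici 0) x := fun x hx => by
    rw [max_eq_left hx]
    exact (Real.hasDerivAt_rpow_const (Or.inr hp.le)).hasDerivWithinAt.congr
      (fun y hy => by rw [max_eq_left hy]) (by rw [max_eq_left hx])
  have hIic : ∀ x ≤ 0, HasDerivWithinAt (fun x : ℝ => max x 0 ^ p) (p * max x 0 ^ (p - 1))
      (Iic 0) x := fun x hx => by
    rw [max_eq_right hx, Real.zero_rpow hp1, mul_zero]
    exact (hasDerivWithinAt_const _ _ (0 : ℝ)).congr
      (fun y hy => by rw [max_eq_right hy, Real.zero_rpow hp0])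
      (by rw [max_eq_right hx, Real.zero_rpow hp0])
  rcases lt_trichotomy x 0 with hx | rfl | hx
  · exact (hIic x hx.le).hasDerivAt (Iic_mem_nhds hx)
  · simpa only [Ici_union_Iic, hasDerivWithinAt_univ] using (hIci 0 le_rfl).union (hIic 0 le_rfl)
  · exact (hIci x hx.le).hasDerivAt (Ici_mem_nhds hx)

variable {m : ℕ}

/-- The monomial `∏ max(t_i, 0) ^ q_i` in the positive parts of the weights. It extends
`∏ t_i ^ q_i` by zero from `E_m` to `ℝ^m`, so that integration by parts over `E_m` becomes
integration by parts over `ℝ^m`, without boundary terms. -/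
noncomputable def posMonomial (q : Fin (m + 1) → ℝ) (t : Fin m → ℝ) : ℝ :=
  ∏ i, max (baryWeights t i) 0 ^ q i

theorem posMonomial_sub_single (q : Fin (m + 1) → ℝ) (t : Fin m → ℝ) (i : Fin (m + 1)) :
    posMonomial (q - Pi.single i 1) t = max (baryWeights t i) 0 ^ (q i - 1) *
      ∏ j ∈ Finset.univ.erase i, max (baryWeights t j) 0 ^ q j := by
  rw [sub_eq_add_neg, ← Pi.single_neg, sub_eq_add_neg]
  exact prod_apply_add_single (fun j x => max (baryWeights t j) 0 ^ x) q i (-1)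

theorem posMonomial_eq_zero {q : Fin (m + 1) → ℝ} (hq : ∀ j, q j ≠ 0) {t : Fin m → ℝ}
    (ht : t ∉ stdSimplexE m) : posMonomial q t = 0 := by
  simp only [mem_stdSimplexE_iff, not_forall, not_le] at ht
  obtain ⟨i, hi⟩ := ht
  refine Finset.prod_eq_zero (Finset.mem_univ i) ?_
  rw [max_eq_right hi.le, Real.zero_rpow (hq i)]

theorem continuous_posMonomial {q : Fin (m + 1) → ℝ} (hq : ∀ j, 0 ≤ q j) :
    Continuous (posMonomial q) :=
  continuous_finsetProd _ fun i _ =>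
    ((continuous_baryWeights i).max continuous_const).rpow_const fun _ => Or.inr (hq i)

theorem integrable_mul_posMonomial {f : (Fin m → ℝ) → ℂ} (hf : Continuous f)
    {q : Fin (m + 1) → ℝ} (hq : ∀ j, 0 < q j) :
    Integrable fun t => f t * (posMonomial q t : ℂ) := by
  refine Continuous.integrable_of_hasCompactSupport
    (hf.mul (Complex.continuous_ofReal.comp (continuous_posMonomial fun j => (hq j).le))) ?_
  refine HasCompactSupport.intro isCompact_stdSimplexE fun t ht => ?_
  simp [posMonomial_eq_zero (fun j => (hq j).ne') ht]

theorem simplexIntegral_eq_integral_posMonomial (h : ℝ → ℂ) {b : Fin (m + 1) → ℝ}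
    (hb : ∀ j, b j ≠ 1) (z : Fin (m + 1) → ℝ) :
    simplexIntegral h (fun i => (b i : ℂ)) z =
      ∫ t : Fin m → ℝ, h (∑ i, baryWeights t i * z i) * (posMonomial (b - 1) t : ℂ) := by
  rw [← setIntegral_eq_integral_of_forall_compl_eq_zero (s := stdSimplexE m)
    fun t ht => by
      rw [posMonomial_eq_zero (fun j => by simpa using sub_ne_zero.2 (hb j)) ht,
        Complex.ofReal_zero, mul_zero]]
  refine setIntegral_congr_fun measurableSet_stdSimplexE fun t ht => ?_
  have ht := mem_stdSimplexE_iff.1 ht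
  simp only [← ofReal_prod_rpow ht, posMonomial, max_eq_left (ht _), Pi.sub_apply, Pi.one_apply]

/-- The direction in `ℝ^m` along which the weight `i` grows and the weight `k` decreases. -/
def baryDirection (i k : Fin (m + 1)) : Fin m → ℝ := fun j =>
  (Pi.single i 1 - Pi.single k 1 : Fin (m + 1) → ℝ) j.succ

theorem baryWeights_add_smul_baryDirection (i k : Fin (m + 1)) (t : Fin m → ℝ) (x : ℝ)
    (j : Fin (m + 1)) :
    baryWeights (t + x • baryDirection i k) j =
      baryWeights t j + x * (Pi.single i 1 - Pi.single k 1 : Fin (m + 1) → ℝ) j := by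
  refine Fin.cases ?_ (fun j => ?_) j
  · have hsum : ∑ j, (Pi.single i 1 - Pi.single k 1 : Fin (m + 1) → ℝ) j = 0 := by simp
    rw [Fin.sum_univ_succ] at hsum
    simp only [baryWeights_zero, Pi.add_apply, Pi.smul_apply, smul_eq_mul, baryDirection,
      Finset.sum_add_distrib, ← Finset.mul_sum, eq_neg_of_add_eq_zero_right hsum]
    ring
  · simp [baryDirection]

theorem hasDerivAt_baryWeights_line (i k : Fin (m + 1)) (t : Fin m → ℝ) (j : Fin (m + 1)) :
    HasDerivAt (fun x : ℝ => baryWeights (t + x • baryDirection i k) j)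
      ((Pi.single i 1 - Pi.single k 1 : Fin (m + 1) → ℝ) j) 0 := by
  simp only [baryWeights_add_smul_baryDirection]
  simpa using ((hasDerivAt_id (0 : ℝ)).mul_const _).const_add (baryWeights t j)

theorem hasLineDerivAt_posMonomial {q : Fin (m + 1) → ℝ} (hq : ∀ j, 1 < q j)
    (i k : Fin (m + 1)) (t : Fin m → ℝ) :
    HasLineDerivAt ℝ (posMonomial q) (q i * posMonomial (q - Pi.single i 1) t -
      q k * posMonomial (q - Pi.single k 1) t) t (baryDirection i k) := by
  have hfactor : ∀ j, HasDerivAt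
      (fun x : ℝ => max (baryWeights (t + x • baryDirection i k) j) 0 ^ q j)
      (q j * max (baryWeights t j) 0 ^ (q j - 1) * (Pi.single i 1 - Pi.single k 1 : _ → ℝ) j) 0 :=
    fun j => (hasDerivAt_max_zero_rpow (hq j) (baryWeights t j)).comp_of_eq (0 : ℝ)
      (hasDerivAt_baryWeights_line i k t j) (by simp)
  have hsum := sum_mul_single_sub_single (fun l => q l * posMonomial (q - Pi.single l 1) t) i k
  refine HasDerivAt.congr_deriv (HasDerivAt.fun_finsetProd fun j _ => hfactor j)
    ((Finset.sum_congr rfl fun l _ => ?_).trans hsum)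
  simp only [zero_smul, add_zero, smul_eq_mul, posMonomial_sub_single]
  ring

theorem hasLineDerivAt_comp_baryWeights {h : ℝ → ℂ} (hh : Differentiable ℝ h)
    (z : Fin (m + 1) → ℝ) (i k : Fin (m + 1)) (t : Fin m → ℝ) :
    HasLineDerivAt ℝ (fun t => h (∑ j, baryWeights t j * z j))
      ((z i - z k : ℝ) * deriv h (∑ j, baryWeights t j * z j)) t (baryDirection i k) := by
  have hsum := HasDerivAt.fun_sum (u := Finset.univ) fun j _ =>
    (hasDerivAt_baryWeights_line i k t j).mul_const (z j)
  simp only [mul_comm _ (z _), sum_mul_single_sub_single] at hsum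
  unfold HasLineDerivAt
  simp only [mul_comm _ (z _)]
  simpa [Function.comp_def] using
    HasDerivAt.scomp_of_eq (0 : ℝ) (hh _).hasDerivAt hsum (by simp)

theorem integral_posMonomial_by_parts {h : ℝ → ℂ} (hh : ContDiff ℝ 1 h) {q : Fin (m + 1) → ℝ}
    (hq : ∀ j, 1 < q j) (z : Fin (m + 1) → ℝ) (i k : Fin (m + 1)) :
    q i * (∫ t : Fin m → ℝ, h (∑ j, baryWeights t j * z j) *
        (posMonomial (q - Pi.single i 1) t : ℂ)) -
      q k * (∫ t : Fin m → ℝ, h (∑ j, baryWeights t j * z j) *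
        (posMonomial (q - Pi.single k 1) t : ℂ)) =
      -((z i - z k : ℝ) * ∫ t : Fin m → ℝ, deriv h (∑ j, baryWeights t j * z j) *
        (posMonomial q t : ℂ)) := by
  have _ : Continuous (deriv h) := hh.continuous_deriv le_rfl
  have hq_sub : ∀ l j, 0 < (q - Pi.single l 1 : _ → ℝ) j := fun l j => by
    rcases eq_or_ne j l with rfl | hj
    · simpa using hq j
    · simpa [hj] using one_pos.trans (hq j)
  have hint : ∀ l, Integrable fun t : Fin m → ℝ => (q l : ℂ) *
      (h (∑ j, baryWeights t j * z j) * (posMonomial (q - Pi.single l 1) t : ℂ)) := fun l =>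
    (integrable_mul_posMonomial (by fun_prop) (hq_sub l)).const_mul _
  have hq_pos : ∀ j, 0 < q j := fun j => one_pos.trans (hq j)
  have hsplit : ∀ t : Fin m → ℝ, h (∑ j, baryWeights t j * z j) *
      ((q i * posMonomial (q - Pi.single i 1) t - q k * posMonomial (q - Pi.single k 1) t : ℝ) : ℂ)
      = q i * (h (∑ j, baryWeights t j * z j) * (posMonomial (q - Pi.single i 1) t : ℂ)) -
        q k * (h (∑ j, baryWeights t j * z j) * (posMonomial (q - Pi.single k 1) t : ℂ)) :=
    fun t => by push_cast; ring
  simp only [← integral_const_mul]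
  rw [← integral_sub (hint i) (hint k), ← integral_congr_ae (.of_forall hsplit)]
  simp only [← mul_assoc]
  refine integral_bilinear_hasLineDerivAt_right_eq_neg_left_of_integrable
    (B := ContinuousLinearMap.mul ℝ ℂ) (v := baryDirection i k)
    (g := fun t => (posMonomial q t : ℂ)) ?_ ?_ ?_
    (fun t _ => hasLineDerivAt_comp_baryWeights (hh.differentiable one_ne_zero) z i k t)
    fun t _ => HasDerivAt.ofReal_comp (hasLineDerivAt_posMonomial hq i k t)
  · exact integrable_mul_posMonomial (by fun_prop) hq_pos
  · simp only [ContinuousLinearMap.mul_apply', hsplit]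
    exact (hint i).sub (hint k)
  · exact integrable_mul_posMonomial (by fun_prop) hq_pos

theorem simplexIntegral_by_parts {h : ℝ → ℂ} (hh : ContDiff ℝ 1 h) {b : Fin (m + 1) → ℝ}
    (hb : ∀ j, 2 < b j) (z : Fin (m + 1) → ℝ) {i k : Fin (m + 1)} (hik : i ≠ k) :
    b i * simplexIntegral h ((fun j => (b j : ℂ)) + Pi.single k 1) z -
      b k * simplexIntegral h ((fun j => (b j : ℂ)) + Pi.single i 1) z =
      -((z i - z k : ℝ) *
        simplexIntegral (deriv h) ((fun j => (b j : ℂ)) + Pi.single i 1 + Pi.single k 1) z) := by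
  have hbi : ∀ l j, 2 < (b + Pi.single l 1 : _ → ℝ) j := fun l j =>
    (hb j).trans_le (le_add_single b l j)
  have hbik : ∀ j, 2 < (b + Pi.single i 1 + Pi.single k 1 : _ → ℝ) j := fun j =>
    (hbi i j).trans_le (le_add_single _ k j)
  have hparts := integral_posMonomial_by_parts hh (q := b + Pi.single i 1 + Pi.single k 1 - 1)
    (fun j => lt_sub_iff_add_lt.2 (by simpa [one_add_one_eq_two] using hbik j)) z i k
  rw [show b + Pi.single i 1 + Pi.single k 1 - 1 - Pi.single i 1 = b + Pi.single k 1 - 1 by abel,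
    show b + Pi.single i 1 + Pi.single k 1 - 1 - Pi.single k 1 = b + Pi.single i 1 - 1 by abel,
    ← simplexIntegral_eq_integral_posMonomial h fun j => by linarith [hbi k j],
    ← simplexIntegral_eq_integral_posMonomial h fun j => by linarith [hbi i j],
    ← simplexIntegral_eq_integral_posMonomial _ fun j => by linarith [hbik j]] at hparts
  simp only [ofReal_add_single] at hparts
  simpa [hik, hik.symm] using hparts

theorem prod_inv_Gamma_add_single {ι : Type*} [Fintype ι] [DecidableEq ι] {b : ι → ℂ} {i : ι}
    (hb : b i ≠ 0) :
    ∏ j, (Complex.Gamma ((b + Pi.single i 1 : ι → ℂ) j))⁻¹ =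
      (b i)⁻¹ * ∏ j, (Complex.Gamma (b j))⁻¹ := by
  rw [prod_apply_add_single fun _ z => (Complex.Gamma z)⁻¹, Complex.Gamma_add_one _ hb, mul_inv,
    mul_assoc, Finset.mul_prod_erase _ (fun j => (Complex.Gamma (b j))⁻¹) (Finset.mem_univ i)]

theorem prod_cpow_add_single {ι : Type*} [Fintype ι] [DecidableEq ι] {u : ι → ℂ} (b : ι → ℂ)
    {i : ι} (hu : u i ≠ 0) :
    ∏ j, u j ^ ((b + Pi.single i 1 : ι → ℂ) j - 1) = u i * ∏ j, u j ^ (b j - 1) := by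
  rw [prod_apply_add_single fun j z => u j ^ (z - 1), add_sub_right_comm, Complex.cpow_add _ _ hu,
    Complex.cpow_one, mul_comm _ (u i), mul_assoc,
    Finset.mul_prod_erase _ (fun j => u j ^ (b j - 1)) (Finset.mem_univ i)]

theorem integrableOn_simplexIntegrand {h : ℝ → ℂ} (hh : Continuous h) {b : Fin (m + 1) → ℂ}
    (hb : b ∈ paramHalfSpace 0) (z : Fin (m + 1) → ℝ) :
    IntegrableOn (fun t => h (∑ i, baryWeights t i * z i) *
      ∏ i, (baryWeights t i : ℂ) ^ (b i - 1)) (stdSimplexE m) := by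
  obtain ⟨U, hU, g, hg, hbound⟩ :=
    exists_integrableOn_simplexIntegrand_bound hh (isCompact_singleton (x := z)) hb
  exact hg.mono' (aestronglyMeasurable_simplexIntegrand hh b z)
    (hbound.mono fun t ht => ht b (mem_of_mem_nhds hU) z rfl)

theorem simplexIntegral_eq_sum {h : ℝ → ℂ} (hh : Continuous h) {b : Fin (m + 1) → ℂ}
    (hb : b ∈ paramHalfSpace 0) (z : Fin (m + 1) → ℝ) :
    simplexIntegral h b z = ∑ i, simplexIntegral h (b + Pi.single i 1) z := by
  simp only [simplexIntegral]
  rw [← integral_finsetSum _ fun i _ =>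
    integrableOn_simplexIntegrand hh (add_single_mem_paramHalfSpace hb i) z]
  refine integral_congr_ae ?_
  filter_upwards [ae_stdSimplexE_baryWeights_mem_Ioc] with t ht
  have hraise := fun i => prod_cpow_add_single (u := fun j => (baryWeights t j : ℂ)) b (i := i)
    (Complex.ofReal_ne_zero.2 (ht i).1.ne')
  simp only [hraise]
  rw [← Finset.mul_sum, ← Finset.sum_mul, ← Complex.ofReal_sum, sum_baryWeights,
    Complex.ofReal_one, one_mul]

theorem reducedAverage_add_single {b : Fin (m + 1) → ℂ} {i : Fin (m + 1)} (hb : b i ≠ 0)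
    (h : ℝ → ℂ) (z : Fin (m + 1) → ℝ) :
    reducedAverage h (b + Pi.single i 1) z = (b i)⁻¹ * (∏ j, (Complex.Gamma (b j))⁻¹) *
      simplexIntegral h (b + Pi.single i 1) z := by
  rw [reducedAverage, prod_inv_Gamma_add_single hb]

theorem reducedAverage_eq_sum {h : ℝ → ℂ} (hh : Continuous h) {b : Fin (m + 1) → ℂ}
    (hb : b ∈ paramHalfSpace 0) (z : Fin (m + 1) → ℝ) :
    reducedAverage h b z = ∑ i, b i * reducedAverage h (b + Pi.single i 1) z := by
  have hne : ∀ i, b i ≠ 0 := fun i h0 => by simpa [h0] using hb i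
  rw [reducedAverage, simplexIntegral_eq_sum hh hb, Finset.mul_sum]
  refine Finset.sum_congr rfl fun i _ => ?_
  rw [reducedAverage_add_single (hne i), ← mul_assoc, mul_inv_cancel_left₀ (hne i)]

theorem reducedAverage_add_single_sub {h : ℝ → ℂ} (hh : ContDiff ℝ 1 h) {b : Fin (m + 1) → ℝ}
    (hb : ∀ j, 2 < b j) (z : Fin (m + 1) → ℝ) (i k : Fin (m + 1)) :
    reducedAverage h ((fun j => (b j : ℂ)) + Pi.single i 1) z -
      reducedAverage h ((fun j => (b j : ℂ)) + Pi.single k 1) z =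
      (z i - z k : ℝ) *
        reducedAverage (deriv h) ((fun j => (b j : ℂ)) + Pi.single i 1 + Pi.single k 1) z := by
  rcases eq_or_ne i k with rfl | hik
  · simp
  have hparts := simplexIntegral_by_parts hh hb z hik
  set β : Fin (m + 1) → ℂ := fun j => (b j : ℂ)
  have hne : ∀ j, β j ≠ 0 := fun j => Complex.ofReal_ne_zero.2 (zero_lt_two.trans (hb j)).ne'
  have hβk : (β + Pi.single i 1 : _ → ℂ) k = β k := by simp [hik.symm]
  rw [reducedAverage_add_single (hne i), reducedAverage_add_single (hne k),
    reducedAverage_add_single (hβk.trans_ne (hne k)), prod_inv_Gamma_add_single (hne i), hβk]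
  have hi := hne i
  have hk := hne k
  generalize ∏ j, (Complex.Gamma (β j))⁻¹ = G
  field_simp
  linear_combination -G * hparts

/-- The operation on families `F`, `F'` of functions of parameters and nodes which recovers the
reduced averages of `h` from those of `h` and `deriv h` at larger parameters `b_k`. -/
def recurrenceStep {ι : Type*} [Fintype ι] [DecidableEq ι] (k : ι)
    (F F' : (ι → ℂ) → (ι → ℝ) → ℂ) (b : ι → ℂ) (z : ι → ℝ) : ℂ :=
  (∑ i, b i) * F (b + Pi.single k 1) z +
    ∑ i, b i * ((z i - z k : ℝ) * F' (b + Pi.single i 1 + Pi.single k 1) z)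

theorem reducedAverage_eq_recurrenceStep {h : ℝ → ℂ} (hh : ContDiff ℝ 1 h)
    {b : Fin (m + 1) → ℝ} (hb : ∀ j, 2 < b j) (z : Fin (m + 1) → ℝ) (k : Fin (m + 1)) :
    reducedAverage h (fun j => (b j : ℂ)) z =
      recurrenceStep k (reducedAverage h) (reducedAverage (deriv h)) (fun j => (b j : ℂ)) z := by
  have hmem : (fun j => (b j : ℂ)) ∈ paramHalfSpace 0 :=
    ofReal_mem_paramHalfSpace (fun _ => le_rfl) fun j => zero_lt_two.trans (hb j)
  rw [recurrenceStep, reducedAverage_eq_sum hh.continuous hmem, Finset.sum_mul,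
    ← Finset.sum_add_distrib]
  refine Finset.sum_congr rfl fun i _ => ?_
  rw [← reducedAverage_add_single_sub hh hb z i k]
  ring

end Recurrence

section Continuation

theorem paramHalfSpace_mono {ι : Type*} {T T' : ι → ℝ} (hT : T ≤ T') :
    paramHalfSpace T ⊆ paramHalfSpace T' := fun _ hb i =>
  (neg_le_neg (hT i)).trans_lt (hb i)

theorem add_single_mem_of_mem_paramHalfSpace_add_single {ι : Type*} [DecidableEq ι] {T : ι → ℝ}
    {k : ι} {b : ι → ℂ} (hb : b ∈ paramHalfSpace (T + Pi.single k 1)) :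
    b + Pi.single k 1 ∈ paramHalfSpace T := fun j => by
  have hbj := hb j
  rcases eq_or_ne j k with rfl | hj
  · simp only [Pi.add_apply, Pi.single_eq_same, Complex.add_re, Complex.one_re] at hbj ⊢
    linarith
  · simpa [hj] using hbj

theorem isContinuationRegion_paramHalfSpace {s : ℕ} {T : Fin s → ℝ} (hT : ∀ i, 0 ≤ T i) :
    IsContinuationRegion (paramHalfSpace T) :=
  ⟨isOpen_paramHalfSpace T, (convex_paramHalfSpace T).isPreconnected, fun _ hb =>
    ofReal_mem_paramHalfSpace hT hb⟩

section RecurrenceStep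

variable {ι : Type*} [Fintype ι] [DecidableEq ι] {T : ι → ℝ} {F F' : (ι → ℂ) → (ι → ℝ) → ℂ}

theorem differentiableOn_recurrenceStep {z : ι → ℝ}
    (hF : DifferentiableOn ℂ (F · z) (paramHalfSpace T))
    (hF' : DifferentiableOn ℂ (F' · z) (paramHalfSpace T)) (k : ι) :
    DifferentiableOn ℂ (recurrenceStep k F F' · z) (paramHalfSpace (T + Pi.single k 1)) := by
  have hFk : DifferentiableOn ℂ (fun b => F (b + Pi.single k 1) z)
      (paramHalfSpace (T + Pi.single k 1)) :=
    hF.comp (f := fun b : ι → ℂ => b + Pi.single k 1) (by fun_prop)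
      fun b hb => add_single_mem_of_mem_paramHalfSpace_add_single hb
  have hFik' : ∀ i, DifferentiableOn ℂ (fun b => F' (b + Pi.single i 1 + Pi.single k 1) z)
      (paramHalfSpace (T + Pi.single k 1)) := fun i =>
    hF'.comp (f := fun b : ι → ℂ => b + Pi.single i 1 + Pi.single k 1) (by fun_prop)
      fun b hb => add_single_mem_of_mem_paramHalfSpace_add_single
        (add_single_mem_paramHalfSpace hb i)
  exact (DifferentiableOn.mul (by fun_prop) hFk).add (DifferentiableOn.fun_sum fun i _ =>
    DifferentiableOn.mul (by fun_prop) ((hFik' i).const_mul _))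

theorem continuousOn_recurrenceStep {Z : Set (ι → ℝ)}
    (hF : ContinuousOn (fun p : (ι → ℂ) × (ι → ℝ) => F p.1 p.2) (paramHalfSpace T ×ˢ Z))
    (hF' : ContinuousOn (fun p : (ι → ℂ) × (ι → ℝ) => F' p.1 p.2) (paramHalfSpace T ×ˢ Z))
    (k : ι) : ContinuousOn (fun p : (ι → ℂ) × (ι → ℝ) => recurrenceStep k F F' p.1 p.2)
      (paramHalfSpace (T + Pi.single k 1) ×ˢ Z) := by
  have hFk : ContinuousOn (fun p : (ι → ℂ) × (ι → ℝ) => F (p.1 + Pi.single k 1) p.2)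
      (paramHalfSpace (T + Pi.single k 1) ×ˢ Z) :=
    hF.comp (f := fun p : (ι → ℂ) × (ι → ℝ) => (p.1 + Pi.single k 1, p.2)) (by fun_prop)
      fun p hp => ⟨add_single_mem_of_mem_paramHalfSpace_add_single hp.1, hp.2⟩
  have hFik' : ∀ i, ContinuousOn
      (fun p : (ι → ℂ) × (ι → ℝ) => F' (p.1 + Pi.single i 1 + Pi.single k 1) p.2)
      (paramHalfSpace (T + Pi.single k 1) ×ˢ Z) := fun i =>
    hF'.comp (f := fun p : (ι → ℂ) × (ι → ℝ) => (p.1 + Pi.single i 1 + Pi.single k 1, p.2))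
      (by fun_prop) fun p hp => ⟨add_single_mem_of_mem_paramHalfSpace_add_single
        (add_single_mem_paramHalfSpace hp.1 i), hp.2⟩
  exact (ContinuousOn.mul (by fun_prop) hFk).add (continuousOn_finsetSum _ fun i _ =>
    ContinuousOn.mul (by fun_prop) (ContinuousOn.mul (by fun_prop) (hFik' i)))

end RecurrenceStep

variable {m : ℕ}

/-- `F` continues the reduced averages of `h` with nodes in `Z` to the parameter vectors in `V`,
holomorphically in the parameters and jointly continuously in the parameters and the nodes. -/
structure IsJointContinuation (V : Set (Fin (m + 1) → ℂ)) (Z : Set (Fin (m + 1) → ℝ))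
    (h : ℝ → ℂ) (F : (Fin (m + 1) → ℂ) → (Fin (m + 1) → ℝ) → ℂ) : Prop where
  differentiableOn : ∀ z ∈ Z, DifferentiableOn ℂ (fun b => F b z) V
  continuousOn : ContinuousOn (fun p : (Fin (m + 1) → ℂ) × (Fin (m + 1) → ℝ) => F p.1 p.2) (V ×ˢ Z)
  eq_reducedAverage : ∀ z ∈ Z, ∀ b : Fin (m + 1) → ℝ, (∀ i, 0 < b i) →
    F (fun i => (b i : ℂ)) z = reducedAverage h (fun i => (b i : ℂ)) z

theorem isJointContinuation_reducedAverage {h : ℝ → ℂ} (hh : Continuous h) :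
    IsJointContinuation (paramHalfSpace (0 : Fin (m + 1) → ℝ)) univ h (reducedAverage h) :=
  ⟨fun z _ => differentiableOn_reducedAverage hh z, continuousOn_reducedAverage hh,
    fun _ _ _ _ => rfl⟩

theorem IsJointContinuation.recurrenceStep_ofReal {T : Fin (m + 1) → ℝ} {h : ℝ → ℂ}
    (hh : ContDiff ℝ 1 h) {F F' : (Fin (m + 1) → ℂ) → (Fin (m + 1) → ℝ) → ℂ}
    (hF : IsJointContinuation (paramHalfSpace T) univ h F)
    (hF' : IsJointContinuation (paramHalfSpace T) univ (deriv h) F') (k : Fin (m + 1))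
    {b : Fin (m + 1) → ℝ} (hb : ∀ i, 2 < b i) (z : Fin (m + 1) → ℝ) :
    recurrenceStep k F F' (fun i => (b i : ℂ)) z = reducedAverage h (fun i => (b i : ℂ)) z := by
  have hpos : ∀ i, 0 < b i := fun i => zero_lt_two.trans (hb i)
  have hpos_add : ∀ {b : Fin (m + 1) → ℝ} (l : Fin (m + 1)), (∀ i, 0 < b i) →
      ∀ i, 0 < (b + Pi.single l 1 : _ → ℝ) i := fun l hb i => (hb i).trans_le (le_add_single _ l i)
  simp only [reducedAverage_eq_recurrenceStep hh hb z k, recurrenceStep, ← ofReal_add_single,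
    hF.eq_reducedAverage z trivial _ (hpos_add k hpos),
    hF'.eq_reducedAverage z trivial _ (hpos_add k (hpos_add _ hpos))]

theorem IsJointContinuation.raise {T : Fin (m + 1) → ℝ} (hT : 0 ≤ T) {h : ℝ → ℂ}
    (hh : ContDiff ℝ 1 h) {F F' : (Fin (m + 1) → ℂ) → (Fin (m + 1) → ℝ) → ℂ}
    (hF : IsJointContinuation (paramHalfSpace T) univ h F)
    (hF' : IsJointContinuation (paramHalfSpace T) univ (deriv h) F') (k : Fin (m + 1)) :
    IsJointContinuation (paramHalfSpace (T + Pi.single k 1)) univ h (recurrenceStep k F F') := by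
  have hdiff := fun z => differentiableOn_recurrenceStep (hF.differentiableOn z trivial)
    (hF'.differentiableOn z trivial) k
  refine ⟨fun z _ => hdiff z, continuousOn_recurrenceStep hF.continuousOn hF'.continuousOn k,
    fun z _ b hb => ?_⟩
  -- The recurrence is available for `b_j > 2` only; the identity theorem does the rest.
  have hlarge : ∀ᶠ b : Fin (m + 1) → ℝ in 𝓝 fun _ => 3, ∀ i, 2 < b i :=
    eventually_all.2 fun i => (continuous_apply i).continuousAt.eventually
      (lt_mem_nhds (by norm_num : (2 : ℝ) < 3))
  exact eqOn_of_eventually_eq_ofReal (isOpen_paramHalfSpace 0)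
    (convex_paramHalfSpace 0).isPreconnected
    ((hdiff z).mono (paramHalfSpace_mono (hT.trans (le_add_single T k))))
    (differentiableOn_reducedAverage hh.continuous z)
    (ofReal_mem_paramHalfSpace (fun _ => le_rfl) fun _ => three_pos)
    (hlarge.mono fun b hb => recurrenceStep_ofReal hh hF hF' k hb z)
    (ofReal_mem_paramHalfSpace (fun _ => le_rfl) hb)

/-- The reduced averages of all sufficiently smooth functions continue to the half space of `T`.
The smoothness needed may grow with `T`, as each step of the recurrence costs a derivative. -/
def HasContinuations (T : Fin (m + 1) → ℝ) : Prop :=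
  ∃ p : ℕ, ∀ h : ℝ → ℂ, ContDiff ℝ p h → ∃ F, IsJointContinuation (paramHalfSpace T) univ h F

theorem HasContinuations.raise {T : Fin (m + 1) → ℝ} (hT : 0 ≤ T) (hc : HasContinuations T)
    (k : Fin (m + 1)) : HasContinuations (T + Pi.single k 1) := by
  obtain ⟨p, hp⟩ := hc
  refine ⟨p + 1, fun h hh => ?_⟩
  push_cast at hh
  obtain ⟨F, hF⟩ := hp h (hh.of_le le_self_add)
  obtain ⟨F', hF'⟩ := hp (deriv h) (contDiff_succ_iff_deriv.1 hh).2.2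
  exact ⟨_, hF.raise hT (hh.of_le le_add_self) hF' k⟩

theorem hasContinuations_count (a : Multiset (Fin (m + 1))) :
    HasContinuations fun i => (a.count i : ℝ) := by
  induction a using Multiset.induction_on with
  | empty =>
    refine ⟨0, fun h hh => ⟨reducedAverage h, ?_⟩⟩
    simpa [← Pi.zero_def] using isJointContinuation_reducedAverage (m := m) hh.continuous
  | cons k a ih =>
    convert ih.raise (fun i => Nat.cast_nonneg (a.count i)) k using 1
    ext i
    simp [Multiset.count_cons, Pi.single_apply]

theorem hasContinuations_natCast (N : ℕ) : HasContinuations fun _ : Fin (m + 1) => (N : ℝ) := by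
  simpa using hasContinuations_count (N • (Finset.univ : Finset (Fin (m + 1))).val)

theorem exists_continuous_extension {a c : ℝ} (hac : a ≤ c) {h : ℝ → ℂ}
    (hh : ContinuousOn h (Icc a c)) : ∃ g : ℝ → ℂ, Continuous g ∧ EqOn g h (Icc a c) :=
  ⟨IccExtend hac ((Icc a c).domRestrict h), hh.domRestrict.Icc_extend', fun x hx => by
    rw [IccExtend_of_mem _ _ hx, domRestrict_apply]⟩

theorem exists_contDiff_extension {a c : ℝ} (hac : a < c) (N : ℕ) :
    ∀ {h : ℝ → ℂ}, ContDiffOn ℝ ∞ h (Icc a c) → ∃ g : ℝ → ℂ, ContDiff ℝ N g ∧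
      EqOn g h (Icc a c) := by
  induction N with
  | zero =>
    intro h hh
    simpa using exists_continuous_extension hac.le hh.continuousOn
  | succ N ih =>
    intro h hh
    have hu := uniqueDiffOn_Icc hac
    obtain ⟨g, hg, hgh⟩ := ih (hh.derivWithin hu (m := ∞) le_rfl)
    set G : ℝ → ℂ := fun x => h a + ∫ t in a..x, g t
    have hG : ∀ x, HasDerivAt G (g x) x := fun x =>
      (intervalIntegral.integral_hasDerivAt_right (hg.continuous.intervalIntegrable _ _)
        hg.continuous.stronglyMeasurable.stronglyMeasurableAtFilter
        hg.continuous.continuousAt).const_add _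
    refine ⟨G, ?_, ?_⟩
    · push_cast
      refine contDiff_succ_iff_deriv.2 ⟨fun x => (hG x).differentiableAt, by simp, ?_⟩
      rwa [show deriv G = g from funext fun x => (hG x).deriv]
    · refine eq_of_derivWithin_eq (fun x _ => (hG x).differentiableAt.differentiableWithinAt)
        (hh.differentiableOn (by simp)) (fun x hx => ?_) (by simp [G])
      rw [(hG x).hasDerivWithinAt.derivWithin (hu x (Ico_subset_Icc_self hx)),
        hgh (Ico_subset_Icc_self hx)]

theorem sum_baryWeights_smul_mem {E : Type*} [AddCommGroup E] [Module ℝ E] {K : Set E}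
    (hK : Convex ℝ K) {z : Fin (m + 1) → E} (hz : ∀ i, z i ∈ K) {t : Fin m → ℝ}
    (ht : t ∈ stdSimplexE m) : ∑ i, baryWeights t i • z i ∈ K :=
  hK.sum_mem (fun i _ => mem_stdSimplexE_iff.1 ht i) (sum_baryWeights t) fun i _ => hz i

theorem reducedAverage_congr {K : Set ℝ} (hK : Convex ℝ K) {g h : ℝ → ℂ} (hgh : EqOn g h K)
    {z : Fin (m + 1) → ℝ} (hz : z ∈ univ.pi fun _ => K) (b : Fin (m + 1) → ℂ) :
    reducedAverage g b z = reducedAverage h b z := by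
  unfold reducedAverage simplexIntegral
  congr 1
  refine setIntegral_congr_fun measurableSet_stdSimplexE fun t ht => ?_
  have hmem := sum_baryWeights_smul_mem hK (fun i => hz i trivial) ht
  simp only [smul_eq_mul] at hmem
  simp only [hgh hmem]

theorem exists_isJointContinuation_paramHalfSpace {a c : ℝ} (hac : a < c) {h : ℝ → ℂ}
    (hh : ContDiffOn ℝ ∞ h (Icc a c)) (N : ℕ) :
    ∃ F, IsJointContinuation (m := m) (paramHalfSpace fun _ => N)
      (univ.pi fun _ => Icc a c) h F := by
  obtain ⟨p, hp⟩ := hasContinuations_natCast (m := m) N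
  obtain ⟨g, hg, hgh⟩ := exists_contDiff_extension hac p hh
  obtain ⟨F, hF⟩ := hp g hg
  refine ⟨F, fun z _ => hF.differentiableOn z trivial,
    hF.continuousOn.mono (prod_mono_right (subset_univ _)), fun z hz b hb => ?_⟩
  rw [hF.eq_reducedAverage z trivial b hb, reducedAverage_congr (convex_Icc a c) hgh hz]

theorem IsJointContinuation.glue {Z : Set (Fin (m + 1) → ℝ)} {h : ℝ → ℂ}
    {S : ℕ → Set (Fin (m + 1) → ℂ)} (hS : ∀ N, IsContinuationRegion (S N)) (hmono : Monotone S)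
    {F : ℕ → (Fin (m + 1) → ℂ) → (Fin (m + 1) → ℝ) → ℂ}
    (hF : ∀ N, IsJointContinuation (S N) Z h (F N)) {ν : (Fin (m + 1) → ℂ) → ℕ}
    (hν : ∀ b, b ∈ S (ν b)) : IsJointContinuation univ Z h fun b => F (ν b) b := by
  have heqOn : ∀ {N N'}, N ≤ N' → ∀ z ∈ Z, EqOn (F N · z) (F N' · z) (S N) := fun hN z hz =>
    IsAnalyticContinuation.eqOn (hS _)
      ⟨(hF _).differentiableOn z hz, (hF _).eq_reducedAverage z hz⟩
      ⟨((hF _).differentiableOn z hz).mono (hmono hN), (hF _).eq_reducedAverage z hz⟩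
  have heq : ∀ N, ∀ z ∈ Z, ∀ b ∈ S N, F (ν b) b z = F N b z := fun N z hz b hb =>
    (le_total N (ν b)).elim (fun hN => (heqOn hN z hz hb).symm) fun hN => heqOn hN z hz (hν b)
  have hnhds : ∀ b, S (ν b) ∈ 𝓝 b := fun b => (hS _).1.mem_nhds (hν b)
  refine ⟨fun z hz b _ => ?_, ?_, fun z hz b hb => (hF _).eq_reducedAverage z hz b hb⟩
  · refine (((hF (ν b)).differentiableOn z hz).differentiableAt (hnhds b)).congr_of_eventuallyEq ?_
      |>.differentiableWithinAt
    exact mem_of_superset (hnhds b) (heq _ z hz)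
  · rintro ⟨b, z⟩ ⟨-, hz⟩
    have hnhds' : S (ν b) ×ˢ Z ∈ 𝓝[univ ×ˢ Z] (b, z) := by
      rw [nhdsWithin_prod_eq, nhdsWithin_univ]
      exact prod_mem_prod (hnhds b) self_mem_nhdsWithin
    refine (((hF (ν b)).continuousOn (b, z) ⟨hν b, hz⟩).mono_of_mem_nhdsWithin
      hnhds').congr_of_eventuallyEq ?_ rfl
    exact mem_of_superset hnhds' fun p hp => heq _ p.2 hp.2 p.1 hp.1

theorem exists_isJointContinuation_univ {a c : ℝ} (hac : a < c) {h : ℝ → ℂ}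
    (hh : ContDiffOn ℝ ∞ h (Icc a c)) :
    ∃ F, IsJointContinuation (m := m) univ (univ.pi fun _ => Icc a c) h F := by
  choose F hF using exists_isJointContinuation_paramHalfSpace (m := m) hac hh
  refine ⟨_, IsJointContinuation.glue (ν := fun b => ⌈‖b‖⌉₊ + 1)
    (fun N => isContinuationRegion_paramHalfSpace fun _ => Nat.cast_nonneg N)
    (fun N N' hN => paramHalfSpace_mono fun _ => Nat.cast_le.2 hN) hF fun b i => ?_⟩
  have hre := (abs_le.1 ((Complex.abs_re_le_norm (b i)).trans (norm_le_pi_norm b i))).1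
  have hceil := Nat.le_ceil ‖b‖
  push_cast
  linarith

theorem exists_continuation_dirichletAverage {a c : ℝ} (hac : a < c) {h : ℝ → ℂ}
    (hh : ContDiffOn ℝ ∞ h (Icc a c)) :
    ∃ H : (Fin (m + 1) → ℂ) → (Fin (m + 1) → ℝ) → ℂ,
      (∀ z ∈ univ.pi fun _ => Icc a c, IsAnalyticContinuation (regularParams (m + 1))
        (fun b => dirichletAverage h b z) fun b => H b z) ∧
      ContinuousOn (fun p : (Fin (m + 1) → ℂ) × (Fin (m + 1) → ℝ) => H p.1 p.2)
        (regularParams (m + 1) ×ˢ univ.pi fun _ => Icc a c) := by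
  obtain ⟨F, hF⟩ := exists_isJointContinuation_univ (m := m) hac hh
  have hGamma : DifferentiableOn ℂ (fun b : Fin (m + 1) → ℂ => Complex.Gamma (∑ i, b i))
      (regularParams (m + 1)) := fun b hb =>
    ((Complex.differentiableAt_Gamma _ hb).comp b (f := fun b => ∑ i, b i)
      (by fun_prop)).differentiableWithinAt
  refine ⟨fun b z => Complex.Gamma (∑ i, b i) * F b z, fun z hz => ⟨?_, fun b hb => ?_⟩, ?_⟩
  · exact hGamma.mul ((hF.differentiableOn z hz).mono (subset_univ _))
  · simp only [dirichletAverage_eq, hF.eq_reducedAverage z hz b hb]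
  · exact (hGamma.continuousOn.comp continuousOn_fst fun p hp => hp.1).mul
      (hF.continuousOn.mono (prod_mono_left (subset_univ _)))

end Continuation

section Spline

variable {n s : ℕ}

/-- The affine map `t ↦ ∑ t_j x^j` from `ℝ^n` to `ℝ^s` which sends the standard simplex `E_n` to
the convex hull of the points `x^j`. -/
def baryMap (X : Fin (n + 1) → Fin s → ℝ) (t : Fin n → ℝ) : Fin s → ℝ :=
  ∑ j, baryWeights t j • X j

theorem continuous_baryMap (X : Fin (n + 1) → Fin s → ℝ) : Continuous (baryMap X) :=
  continuous_finsetSum _ fun j _ => (continuous_baryWeights j).smul continuous_const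

theorem baryMap_mem_convexHull (X : Fin (n + 1) → Fin s → ℝ) {t : Fin n → ℝ}
    (ht : t ∈ stdSimplexE n) : baryMap X t ∈ convexHull ℝ (range X) :=
  sum_baryWeights_smul_mem (convex_convexHull ℝ _)
    (fun j => subset_convexHull ℝ _ (mem_range_self j)) ht

/-- The linear part `t ↦ ∑ t_j (x^j - x^0)` of `baryMap X`. -/
def baryLinear (X : Fin (n + 1) → Fin s → ℝ) : (Fin n → ℝ) →ₗ[ℝ] (Fin s → ℝ) :=
  Fintype.linearCombination ℝ fun j : Fin n => X j.succ - X 0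

theorem baryMap_eq (X : Fin (n + 1) → Fin s → ℝ) (t : Fin n → ℝ) :
    baryMap X t = X 0 + baryLinear X t := by
  simp only [baryMap, baryLinear, Fintype.linearCombination_apply, Fin.sum_univ_succ,
    baryWeights_zero, baryWeights_succ, smul_sub, Finset.sum_sub_distrib, sub_smul, one_smul,
    Finset.sum_smul]
  abel

theorem surjective_baryLinear {X : Fin (n + 1) → Fin s → ℝ}
    (hX : 0 < volume (convexHull ℝ (range X))) : Function.Surjective (baryLinear X) := by
  rw [← LinearMap.range_eq_top]
  by_contra hne
  have hnull : volume (LinearMap.range (baryLinear X) : Set (Fin s → ℝ)) = 0 :=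
    Measure.addHaar_submodule volume _ hne
  have hsub : convexHull ℝ (range X) ⊆
      (fun y => -X 0 + y) ⁻¹' (LinearMap.range (baryLinear X) : Set (Fin s → ℝ)) := by
    refine convexHull_min ?_ ((Submodule.convex _).translate_preimage_right _)
    rintro _ ⟨j, rfl⟩
    refine Fin.cases ⟨0, by simp⟩ (fun j => ⟨Pi.single j 1, ?_⟩) j
    simp [baryLinear, sub_eq_neg_add]
  have hle := measure_mono (μ := volume) hsub
  rw [measure_preimage_add, hnull] at hle
  exact hle.not_gt hX

theorem map_baryMap_absolutelyContinuous {X : Fin (n + 1) → Fin s → ℝ}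
    (hX : 0 < volume (convexHull ℝ (range X))) :
    Measure.map (baryMap X) volume ≪ (volume : Measure (Fin s → ℝ)) := by
  refine Measure.AbsolutelyContinuous.mk fun A hA hA0 => ?_
  rw [Measure.map_apply (continuous_baryMap X).measurable hA, measure_eq_zero_iff_ae_notMem]
  have htranslate : ∀ᵐ y : Fin s → ℝ, y ∉ (fun y => X 0 + y) ⁻¹' A :=
    measure_eq_zero_iff_ae_notMem.1 (by rwa [measure_preimage_add])
  have hlinear := (ae_comp_linearMap_mem_iff (baryLinear X) volume volume
    (surjective_baryLinear hX) (measurable_const_add (X 0) hA).compl).2 htranslate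
  filter_upwards [hlinear] with t ht hmem
  exact ht (by simpa [baryMap_eq] using hmem)

theorem measurable_dirichletDensity (d : Fin (n + 1) → ℝ) : Measurable (dirichletDensity d) :=
  measurable_const.mul <| Finset.measurable_fun_prod _ fun i _ =>
    measurable_const.mul ((continuous_baryWeights i).measurable.pow_const _)

/-- The distribution of `∑ t_j x^j` for a point `t` of `E_n` with the Dirichlet density `φ_d`; the
Dirichlet spline is its density. -/
noncomputable def dirichletImage (d : Fin (n + 1) → ℝ) (X : Fin (n + 1) → Fin s → ℝ) :
    Measure (Fin s → ℝ) :=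
  Measure.map (baryMap X) ((volume.restrict (stdSimplexE n)).withDensity
    fun t => ENNReal.ofReal (dirichletDensity d t))

variable {d : Fin (n + 1) → ℝ} {X : Fin (n + 1) → Fin s → ℝ}

theorem isFiniteMeasure_dirichletImage (hd : ∀ j, 0 < d j) :
    IsFiniteMeasure (dirichletImage d X) := by
  have := isFiniteMeasure_withDensity_ofReal (integrableOn_dirichletDensity hd).2
  exact Measure.isFiniteMeasure_map _ _

theorem dirichletImage_absolutelyContinuous (hX : 0 < volume (convexHull ℝ (range X))) :
    dirichletImage d X ≪ volume :=
  (((withDensity_absolutelyContinuous _ _).trans Measure.restrict_le_self.absolutelyContinuous).map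
    (continuous_baryMap X).measurable).trans (map_baryMap_absolutelyContinuous hX)

theorem integral_dirichletImage (hd : ∀ j, 0 < d j) {E : Type*} [NormedAddCommGroup E]
    [NormedSpace ℝ E] {g : (Fin s → ℝ) → E} (hg : AEStronglyMeasurable g (dirichletImage d X)) :
    ∫ x, g x ∂(dirichletImage d X) =
      ∫ t in stdSimplexE n, dirichletDensity d t • g (baryMap X t) := by
  rw [dirichletImage, integral_map (continuous_baryMap X).aemeasurable hg,
    integral_withDensity_eq_integral_toReal_smul
      (measurable_dirichletDensity d).ennreal_ofReal (by simp)]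
  refine setIntegral_congr_fun measurableSet_stdSimplexE fun t ht => ?_
  simp only [ENNReal.toReal_ofReal (dirichletDensity_nonneg hd ht)]

theorem isDirichletSpline_rnDeriv (hX : 0 < volume (convexHull ℝ (range X)))
    (hd : ∀ j, 0 < d j) :
    IsDirichletSpline d X fun x => ((dirichletImage d X).rnDeriv volume x).toReal := by
  have := isFiniteMeasure_dirichletImage (X := X) hd
  refine ⟨Measure.integrable_toReal_rnDeriv.locallyIntegrable, fun f hf _ => ?_⟩
  simp only [mul_comm (f _)]
  rw [integral_toReal_rnDeriv_mul (dirichletImage_absolutelyContinuous hX),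
    integral_dirichletImage hd hf.aestronglyMeasurable]
  simp only [smul_eq_mul, baryMap]

namespace IsDirichletSpline

variable {M : (Fin s → ℝ) → ℝ}

theorem ae_eq (hM : IsDirichletSpline d X M) {M' : (Fin s → ℝ) → ℝ}
    (hM' : IsDirichletSpline d X M') : M =ᵐ[volume] M' :=
  ae_eq_of_integral_contDiff_smul_eq hM.1 hM'.1 fun g hg hgs => by
    simp only [smul_eq_mul, hM.2 g hg.continuous hgs, hM'.2 g hg.continuous hgs]

theorem integrableOn_convexHull (hM : IsDirichletSpline d X M) :
    IntegrableOn M (convexHull ℝ (range X)) :=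
  hM.1.integrableOn_isCompact ((finite_range X).isCompact_convexHull ℝ)

theorem integrableOn_mul (hM : IsDirichletSpline d X M) {g : (Fin s → ℝ) → ℂ}
    (hg : ContinuousOn g (convexHull ℝ (range X))) :
    IntegrableOn (fun x => (M x : ℂ) * g x) (convexHull ℝ (range X)) :=
  IntegrableOn.mul_continuousOn (g := fun x => (M x : ℂ)) hM.integrableOn_convexHull.ofReal hg
    ((finite_range X).isCompact_convexHull ℝ)

theorem setIntegral_mul (hX : 0 < volume (convexHull ℝ (range X))) (hd : ∀ j, 0 < d j)
    (hM : IsDirichletSpline d X M) {g : (Fin s → ℝ) → ℂ}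
    (hg : ContinuousOn g (convexHull ℝ (range X))) :
    ∫ x in convexHull ℝ (range X), (M x : ℂ) * g x =
      ∫ t in stdSimplexE n, g (baryMap X t) * (dirichletDensity d t : ℂ) := by
  have := isFiniteMeasure_dirichletImage (X := X) hd
  have hK := ((finite_range X).isCompact_convexHull ℝ).measurableSet
  have hgm : AEStronglyMeasurable ((convexHull ℝ (range X)).indicator g) (dirichletImage d X) :=
    (aestronglyMeasurable_indicator_iff hK).2 (hg.aestronglyMeasurable hK)
  calc ∫ x in convexHull ℝ (range X), (M x : ℂ) * g x
    _ = ∫ x, ((dirichletImage d X).rnDeriv volume x).toReal •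
          (convexHull ℝ (range X)).indicator g x := by
      rw [← integral_indicator hK]
      refine integral_congr_ae ?_
      filter_upwards [hM.ae_eq (isDirichletSpline_rnDeriv hX hd)] with x hx
      by_cases hxK : x ∈ convexHull ℝ (range X) <;> simp [hxK, hx]
    _ = ∫ x, (convexHull ℝ (range X)).indicator g x ∂(dirichletImage d X) :=
      integral_rnDeriv_smul (dirichletImage_absolutelyContinuous hX)
    _ = ∫ t in stdSimplexE n, g (baryMap X t) * (dirichletDensity d t : ℂ) := by
      rw [integral_dirichletImage hd hgm]
      refine setIntegral_congr_fun measurableSet_stdSimplexE fun t ht => ?_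
      simp [baryMap_mem_convexHull X ht, mul_comm]

end IsDirichletSpline

end Spline

section Main

variable {n r : ℕ} {X : Fin (n + 1) → Fin (r + 1) → ℝ} {d : Fin (n + 1) → ℝ} {h : ℝ → ℂ}

theorem convexHull_range_subset_pi_entryInterval (X : Fin (n + 1) → Fin (r + 1) → ℝ) :
    convexHull ℝ (range X) ⊆ univ.pi fun _ => entryInterval X := by
  refine convexHull_min ?_ (convex_pi fun _ _ => convex_Icc _ _)
  rintro _ ⟨j, rfl⟩ i -
  exact ⟨(ciInf_le (finite_range _).bddBelow j).trans (ciInf_le (finite_range _).bddBelow i),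
    (le_ciSup (f := fun i => X j i) (finite_range _).bddAbove i).trans
      (le_ciSup (f := fun j => ⨆ i, X j i) (finite_range _).bddAbove j)⟩

theorem iInf_lt_iSup_of_volume_pos (hX : 0 < volume (convexHull ℝ (range X))) :
    ⨅ j, ⨅ i, X j i < ⨆ j, ⨆ i, X j i := by
  have hvol := hX.trans_le (measure_mono (convexHull_range_subset_pi_entryInterval X))
  rw [volume_pi_pi] at hvol
  simpa [entryInterval] using CanonicallyOrderedAdd.prod_pos.1 hvol 0 (Finset.mem_univ _)

theorem continuousOn_dirichletAverage {a c : ℝ} (hac : a ≤ c) (hh : ContinuousOn h (Icc a c))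
    {b : Fin (r + 1) → ℝ} (hb : ∀ i, 0 < b i) :
    ContinuousOn (dirichletAverage h b) (univ.pi fun _ => Icc a c) := by
  obtain ⟨g, hg, hgh⟩ := exists_continuous_extension hac hh
  have hcont : Continuous (reducedAverage g fun i => (b i : ℂ)) := continuousOn_univ.1 <|
    ContinuousOn.uncurry_left _ (ofReal_mem_paramHalfSpace (fun _ => le_rfl) hb)
      (continuousOn_reducedAverage hg)
  refine (hcont.const_mul (Complex.Gamma (∑ i, (b i : ℂ)))).continuousOn.congr fun z hz => ?_
  rw [dirichletAverage_eq, ← reducedAverage_congr (convex_Icc a c) hgh hz]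

theorem doubleDirichletAverage_eq (h : ℝ → ℂ) (b : Fin (r + 1) → ℝ)
    (X : Fin (n + 1) → Fin (r + 1) → ℝ) (d : Fin (n + 1) → ℝ) :
    doubleDirichletAverage h b X d = ∫ v in stdSimplexE n,
      dirichletAverage h b (baryMap X v) * (dirichletDensity d v : ℂ) := by
  have hsum : ∀ (u : Fin r → ℝ) (v : Fin n → ℝ),
      ∑ i, ∑ j, baryWeights u i * X j i * baryWeights v j =
        ∑ i, baryWeights u i * baryMap X v i := fun u v => by
    simp only [baryMap, Finset.sum_apply, Pi.smul_apply, smul_eq_mul, Finset.mul_sum,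
      mul_assoc, mul_comm (X _ _)]
  simp only [doubleDirichletAverage, dirichletAverage, hsum, integral_mul_const]

theorem doubleDirichletAverage_eq_setIntegral (hX : 0 < volume (convexHull ℝ (range X)))
    (hd : ∀ j, 0 < d j) {M : (Fin (r + 1) → ℝ) → ℝ} (hM : IsDirichletSpline d X M)
    {b : Fin (r + 1) → ℝ} (hc : ContinuousOn (dirichletAverage h b) (convexHull ℝ (range X))) :
    doubleDirichletAverage h b X d =
      ∫ x in convexHull ℝ (range X), (M x : ℂ) * dirichletAverage h b x := by
  rw [hM.setIntegral_mul hX hd hc, doubleDirichletAverage_eq]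

theorem isAnalyticContinuation_setIntegral (hX : 0 < volume (convexHull ℝ (range X)))
    (hd : ∀ j, 0 < d j) {M : (Fin (r + 1) → ℝ) → ℝ} (hM : IsDirichletSpline d X M)
    {V : Set (Fin (r + 1) → ℂ)} (hV : IsContinuationRegion V)
    {H : (Fin (r + 1) → ℂ) → (Fin (r + 1) → ℝ) → ℂ}
    (hH : ∀ x ∈ convexHull ℝ (range X),
      IsAnalyticContinuation V (fun b => dirichletAverage h b x) fun b => H b x)
    (hc : ContinuousOn (fun p : (Fin (r + 1) → ℂ) × (Fin (r + 1) → ℝ) => H p.1 p.2)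
      (V ×ˢ convexHull ℝ (range X))) :
    IsAnalyticContinuation V (fun b => doubleDirichletAverage h b X d)
      fun b => ∫ x in convexHull ℝ (range X), (M x : ℂ) * H b x := by
  have hK := (finite_range X).isCompact_convexHull ℝ
  refine ⟨differentiableOn_setIntegral_mul (M := fun x => (M x : ℂ)) hK hK.measurableSet
    hM.integrableOn_convexHull.ofReal hV.1 (fun x hx => (hH x hx).1) hc, fun b hb => ?_⟩
  have heq : EqOn (H fun i => (b i : ℂ)) (dirichletAverage h b) (convexHull ℝ (range X)) :=
    fun x hx => (hH x hx).2 b hb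
  exact (setIntegral_congr_fun hK.measurableSet fun x hx => by simp only [heq hx]).trans
    (doubleDirichletAverage_eq_setIntegral hX hd hM
      ((hc.uncurry_left _ (hV.2.2 b hb)).congr heq.symm)).symm

theorem exists_continuation_dirichletAverage_convexHull
    (hX : 0 < volume (convexHull ℝ (range X))) (hh : ContDiffOn ℝ ∞ h (entryInterval X)) :
    ∃ H : (Fin (r + 1) → ℂ) → (Fin (r + 1) → ℝ) → ℂ,
      (∀ x ∈ convexHull ℝ (range X), IsAnalyticContinuation (regularParams (r + 1))
        (fun b => dirichletAverage h b x) fun b => H b x) ∧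
      ContinuousOn (fun p : (Fin (r + 1) → ℂ) × (Fin (r + 1) → ℝ) => H p.1 p.2)
        (regularParams (r + 1) ×ˢ convexHull ℝ (range X)) := by
  obtain ⟨H, hH, hc⟩ := exists_continuation_dirichletAverage (m := r)
    (iInf_lt_iSup_of_volume_pos hX) hh
  have hsub := convexHull_range_subset_pi_entryInterval X
  exact ⟨H, fun x hx => hH x (hsub hx), hc.mono (prod_mono_right hsub)⟩

end Main

theorem theorem6p1 (r n : ℕ) (X : Fin (n + 1) → Fin (r + 1) → ℝ)
    (hX : 0 < volume (convexHull ℝ (range X)))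
    (d : Fin (n + 1) → ℝ) (hd : ∀ j, 0 < d j)
    (h : ℝ → ℂ) (hh : ContinuousOn h (entryInterval X)) :
    -- the Dirichlet spline exists
    (∃ M, IsDirichletSpline d X M) ∧
    ∀ M, IsDirichletSpline d X M →
      -- positive parameters
      (∀ b : Fin (r + 1) → ℝ, (∀ i, 0 < b i) →
        IntegrableOn (fun x => (M x : ℂ) * dirichletAverage h b x) (convexHull ℝ (range X)) ∧
        doubleDirichletAverage h b X d =
          ∫ x in convexHull ℝ (range X), (M x : ℂ) * dirichletAverage h b x) ∧
      -- continuous `h`: all regions to which the single averages continue, continuously in `x`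
      (∀ (V : Set (Fin (r + 1) → ℂ)) (H : (Fin (r + 1) → ℂ) → (Fin (r + 1) → ℝ) → ℂ),
        IsContinuationRegion V →
        (∀ x ∈ convexHull ℝ (range X),
          IsAnalyticContinuation V (fun b => dirichletAverage h b x) (fun b => H b x)) →
        ContinuousOn (fun p : (Fin (r + 1) → ℂ) × (Fin (r + 1) → ℝ) => H p.1 p.2)
          (V ×ˢ convexHull ℝ (range X)) →
        (∃ D, IsAnalyticContinuation V (fun b => doubleDirichletAverage h b X d) D) ∧
        ∀ D, IsAnalyticContinuation V (fun b => doubleDirichletAverage h b X d) D →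
          ∀ b ∈ V,
            IntegrableOn (fun x => (M x : ℂ) * H b x) (convexHull ℝ (range X)) ∧
            D b = ∫ x in convexHull ℝ (range X), (M x : ℂ) * H b x) ∧
      -- smooth `h`: the averages continue to all `b` with `c ≠ 0, -1, -2, …`
      (ContDiffOn ℝ ∞ h (entryInterval X) →
        (∀ x ∈ convexHull ℝ (range X), ∃ F,
          IsAnalyticContinuation (regularParams (r + 1)) (fun b => dirichletAverage h b x) F) ∧
        (∃ D, IsAnalyticContinuation (regularParams (r + 1))
          (fun b => doubleDirichletAverage h b X d) D) ∧
        ∀ (H : (Fin (r + 1) → ℂ) → (Fin (r + 1) → ℝ) → ℂ) (D : (Fin (r + 1) → ℂ) → ℂ),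
          (∀ x ∈ convexHull ℝ (range X),
            IsAnalyticContinuation (regularParams (r + 1))
              (fun b => dirichletAverage h b x) (fun b => H b x)) →
          IsAnalyticContinuation (regularParams (r + 1))
            (fun b => doubleDirichletAverage h b X d) D →
          ∀ b ∈ regularParams (r + 1),
            IntegrableOn (fun x => (M x : ℂ) * H b x) (convexHull ℝ (range X)) ∧
            D b = ∫ x in convexHull ℝ (range X), (M x : ℂ) * H b x) := by
  refine ⟨⟨_, isDirichletSpline_rnDeriv hX hd⟩, fun M hM => ⟨fun b hb => ?_,
    fun V H hV hH hc => ?_, fun hsmooth => ?_⟩⟩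
  · have hc := (continuousOn_dirichletAverage (iInf_lt_iSup_of_volume_pos hX).le hh hb).mono
      (convexHull_range_subset_pi_entryInterval X)
    exact ⟨hM.integrableOn_mul hc, doubleDirichletAverage_eq_setIntegral hX hd hM hc⟩
  · have hD₀ := isAnalyticContinuation_setIntegral hX hd hM hV hH hc
    exact ⟨⟨_, hD₀⟩, fun D hD b hb =>
      ⟨hM.integrableOn_mul (hc.uncurry_left b hb), hD.eqOn hV hD₀ hb⟩⟩
  · have hV := isContinuationRegion_regularParams (s := r)
    obtain ⟨H₀, hH₀, hc₀⟩ := exists_continuation_dirichletAverage_convexHull hX hsmooth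
    refine ⟨fun x hx => ⟨_, hH₀ x hx⟩,
      ⟨_, isAnalyticContinuation_setIntegral hX hd hM hV hH₀ hc₀⟩, fun H D hH hD b hb => ?_⟩
    have hc := hc₀.congr fun p hp => (hH p.2 hp.2).eqOn hV (hH₀ p.2 hp.2) hp.1
    exact ⟨hM.integrableOn_mul (hc.uncurry_left b hb),
      hD.eqOn hV (isAnalyticContinuation_setIntegral hX hd hM hV hH hc) hb⟩
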